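/- For a homeomorphism $f$ of a topological space $X$, call $f$ topologically transitive if for all nonempty open $U,V\subset X$ there is $n\ge 1$ with $f^n(U)\cap V\neq\emptyset$. Let $\omega f(x)$ be the set of limit points of the sequence $(f^n(x))_{n\ge 1}$, i.e. $\omega f(x)=\bigcap_{N}\overline{\{f^n(x):n\ge N\}}$, let $\alpha f(x)=\omega (f^{-1})(x)$, and let $H(X)$ be the group of all homeomorphisms of $X$ onto itself. Let $W$ be a Cantor set (a nonempty, compact, metrizable, perfect, zero-dimensional space) and let $g$ be a totally transitive homeomorphism of $W$, i.e. $g^n$ is topologically transitive for every $n\in\mathbb Z\setminus\{0\}$. Let $Y$ be the suspension of $g$, the quotient of $W\times[0,1]$ identifying $(x,1)$ with $(g(x),0)$ for all $x\in W$, with the flow $\phi^t(x,s)=(g^{\lfloor t+s\rfloor}(x),\{t+s\})$, $t\in\mathbb R$, where $\lfloor\cdot\rfloor$ and $\{\cdot\}$ are the integer and fractional parts. Let $x_0\in W$ be such that $\{g^{nk}(x_0):k\ge 1\}$ is dense in $W$ for every $n\in\mathbb Z\setminus\{0\}$, and put $y_0=(x_0,0)\in Y$. Let $\tau\in(0,1)$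 be such that $\omega\phi^{n\tau}(y_0)=Y=\alpha\phi^{n\tau}(y_0)$ for every $n\in\mathbb Z\setminus\{0\}$, and let $f=\phi^\tau$. Let $(a_n)_{n\in\mathbb Z}$ be positive reals with $\sum_{n}a_n=1$ and $\{|\ln a_n-\ln a_{n-1}|:n\in\mathbb Z\}$ bounded. Let $u:Y\setminus\{y_0\}\to[0,1]$ be any continuous function with $$u(\phi^t(y_0))=\begin{cases}0,&-\tfrac12\le t<0,\\ \tfrac12\left(1-\cos(\pi/t)\right),&0<t\le\tfrac12.\end{cases}$$ Let $Y'=Y\setminus\{f^n(y_0):n\in\mathbb Z\}$, let $u'=\sum_{n\in\mathbb Z}a_n\,u\circ f^n$ on $Y'$, and let $X$ be the closure of the graph $\{(y,u'(y)):y\in Y'\}$ in $Y\times[0,1]$. Then there is exactly one homeomorphism $h$ of $X$ with $h(y,u'(y))=(f(y),u'(f(y)))$ for all $y\in Y'$. For this $h$, $$H(X)=\{h^n:n\in\mathbb Z\},$$ and $h^n$ is topologically transitive on $X$ for every $n\in\mathbb Z\setminus\{0\}$. -/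

import Mathlib

open Set Filter Topology

noncomputable section

namespace SlovakConstruction

/-! Dynamical notions. A power `f ^ n` of `f : X ≃ₜ X`, with `n` a natural number or an integer, is
taken in the homeomorphism group of `X`, whose product is composition. -/

section Dynamics

variable {X : Type*} [TopologicalSpace X]

/-- Topological transitivity: for all nonempty open `U`, `V` some iterate `f ^ n` with `n ≥ 1`
maps a point of `U` into `V`. -/
def TopTransitive (f : X ≃ₜ X) : Prop :=
  ∀ U V : Set X, IsOpen U → U.Nonempty → IsOpen V → V.Nonempty →
    ∃ n : ℕ, 1 ≤ n ∧ ((f ^ n) '' U ∩ V).Nonempty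

/-- Total transitivity: every nonzero power is topologically transitive. -/
def TotallyTransitive (f : X ≃ₜ X) : Prop :=
  ∀ n : ℤ, n ≠ 0 → TopTransitive (f ^ n)

/-- Transitive points: the forward orbit `f x, f² x, …` is dense. -/
def IsTransPt (f : X ≃ₜ X) (x : X) : Prop :=
  closure {y : X | ∃ n : ℕ, 1 ≤ n ∧ y = (f ^ n) x} = univ

/-- The omega limit set of the point `x`: the limit points of the sequence `f x, f² x, …`. -/
def omegaPt (f : X ≃ₜ X) (x : X) : Set X :=
  omegaLimit atTop (fun (n : ℕ) (y : X) => (f ^ n) y) {x}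

/-- The alpha limit set of the point `x`. -/
def alphaPt (f : X ≃ₜ X) (x : X) : Set X :=
  omegaPt f⁻¹ x

end Dynamics

/-! The suspension of a homeomorphism and its flow. -/

section Suspension

variable {W : Type*} [TopologicalSpace W] (g : W ≃ₜ W)

/-- The relation identifying `(x, 1)` with `(g x, 0)`. -/
def Glue (p q : W × unitInterval) : Prop :=
  p.2 = 1 ∧ q.2 = 0 ∧ q.1 = g p.1

/-- The suspension: the quotient of `W × [0,1]` by the equivalence relation generated by
`(x, 1) ~ (g x, 0)`. -/
def Susp : Type _ := Quot (Glue g)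

/-- The quotient topology. -/
instance : TopologicalSpace (Susp g) :=
  inferInstanceAs (TopologicalSpace (Quot (Glue g)))

/-- The class of `(x, s)` in the suspension. -/
def Susp.mk (x : W) (s : unitInterval) : Susp g := Quot.mk _ (x, s)

/-- The point of the suspension with coordinates `(g^[r] x, {r})`, with `[r]` the integer part
and `{r}` the fractional part of the real number `r`. -/
def Susp.pt (x : W) (r : ℝ) : Susp g :=
  Susp.mk g ((g ^ ⌊r⌋) x) ⟨Int.fract r, Int.fract_nonneg r, (Int.fract_lt_one r).le⟩

theorem Susp.continuous_mk : Continuous fun p : W × unitInterval => Susp.mk g p.1 p.2 :=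
  continuous_quot_mk

theorem Susp.mk_one (x : W) : Susp.mk g x 1 = Susp.mk g (g x) 0 :=
  Quot.sound ⟨rfl, rfl, rfl⟩

theorem Susp.pt_add_int (x : W) (r : ℝ) (n : ℤ) :
    Susp.pt g x (r + n) = Susp.pt g ((g ^ n) x) r := by
  unfold Susp.pt
  have h1 : (g ^ ⌊r + (n : ℝ)⌋) x = (g ^ ⌊r⌋) ((g ^ n) x) := by
    rw [Int.floor_add_intCast, zpow_add]; rfl
  simp only [h1, Int.fract_add_intCast]

/-- On `W × [n, n+1]` the point `pt x r` is the class of `(g^n x, r - n)`. -/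
theorem Susp.pt_eq_mk (x : W) (r : ℝ) (n : ℤ) (h : r ∈ Icc (n : ℝ) (n + 1)) :
    Susp.pt g x r = Susp.mk g ((g ^ n) x) (projIcc 0 1 zero_le_one (r - n)) := by
  rcases eq_or_lt_of_le h.2 with h2 | h2
  · subst h2
    have e : (n : ℝ) + 1 = 0 + ((n + 1 : ℤ) : ℝ) := by push_cast; ring
    have e1 : (g ^ (n + 1)) x = g ((g ^ n) x) := by rw [add_comm, zpow_add, zpow_one]; rfl
    have e2 : projIcc (0 : ℝ) 1 zero_le_one (n + 1 - n) = 1 :=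
      projIcc_of_right_le _ (by linarith)
    rw [e2, Susp.mk_one, e, Susp.pt_add_int, e1]
    unfold Susp.pt
    congr 1
    · simp
    · ext; simp
  · have hf : ⌊r⌋ = n := Int.floor_eq_iff.2 ⟨h.1, h2⟩
    unfold Susp.pt
    rw [hf]
    congr 1
    rw [projIcc_of_mem zero_le_one (⟨by linarith [h.1], by linarith⟩ : r - n ∈ Icc (0 : ℝ) 1)]
    ext
    simp only [Int.fract, hf]

theorem Susp.pt_coe (x : W) (s : unitInterval) : Susp.pt g x (s : ℝ) = Susp.mk g x s := by
  have h := Susp.pt_eq_mk g x (s : ℝ) 0 (by simp)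
  simpa [projIcc_val] using h

theorem Susp.continuous_pt : Continuous fun p : W × ℝ => Susp.pt g p.1 p.2 := by
  have hloc : LocallyFinite fun n : ℤ => (Prod.snd : W × ℝ → ℝ) ⁻¹' Icc (n : ℝ) (n + 1) := by
    apply LocallyFinite.preimage_continuous _ continuous_snd
    intro r
    refine ⟨Ioo (r - 1) (r + 1), Ioo_mem_nhds (by linarith) (by linarith), ?_⟩
    refine (finite_Icc (⌊r⌋ - 2) (⌊r⌋ + 2)).subset ?_
    rintro n ⟨y, hy1, hy2⟩
    have h1 := Int.floor_le r
    have h2 := Int.lt_floor_add_one r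
    constructor
    · have : ((⌊r⌋ - 2 : ℤ) : ℝ) < n := by push_cast; linarith [hy1.2, hy2.1]
      exact_mod_cast this.le
    · have : (n : ℝ) < ((⌊r⌋ + 2 : ℤ) : ℝ) := by push_cast; linarith [hy1.1, hy2.2]
      exact_mod_cast this.le
  refine hloc.continuous ?_ (fun n => isClosed_Icc.preimage continuous_snd) ?_
  · refine eq_univ_of_forall fun p => mem_iUnion.2 ⟨⌊p.2⌋, ?_⟩
    exact ⟨Int.floor_le _, (Int.lt_floor_add_one _).le⟩
  · intro n
    have hc : Continuous fun p : W × ℝ =>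
        Susp.mk g ((g ^ n) p.1) (projIcc 0 1 zero_le_one (p.2 - n)) :=
      (Susp.continuous_mk g).comp
        (f := fun p : W × ℝ => ((g ^ n) p.1, projIcc (0 : ℝ) 1 zero_le_one (p.2 - n)))
        (((g ^ n).continuous.comp continuous_fst).prodMk
          (continuous_projIcc.comp (continuous_snd.sub continuous_const)))
    exact hc.continuousOn.congr fun p hp => Susp.pt_eq_mk g p.1 p.2 n hp

/-- The map `φ^t (x, s) = (g^[t+s] x, {t+s})` on the suspension. -/
def flowMap (t : ℝ) : Susp g → Susp g :=
  Quot.lift (fun p : W × unitInterval => Susp.pt g p.1 (t + (p.2 : ℝ))) <| by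
    rintro ⟨x, s⟩ ⟨y, r⟩ ⟨hs, hr, hy⟩
    dsimp only at hs hr hy
    subst hs hr hy
    have := Susp.pt_add_int g x t 1
    simpa using this

theorem flowMap_mk (t : ℝ) (x : W) (s : unitInterval) :
    flowMap g t (Susp.mk g x s) = Susp.pt g x (t + s) := rfl

theorem flowMap_pt (t : ℝ) (x : W) (r : ℝ) : flowMap g t (Susp.pt g x r) = Susp.pt g x (t + r) := by
  have h : t + r = (t + Int.fract r) + (⌊r⌋ : ℝ) := by rw [Int.fract]; ring
  rw [h, Susp.pt_add_int]
  rfl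

theorem flowMap_add (t r : ℝ) (y : Susp g) : flowMap g (t + r) y = flowMap g t (flowMap g r y) := by
  induction y using Quot.ind with
  | mk p =>
    change Susp.pt g p.1 (t + r + p.2) = flowMap g t (Susp.pt g p.1 (r + p.2))
    rw [flowMap_pt, add_assoc]

theorem flowMap_zero (y : Susp g) : flowMap g 0 y = y := by
  induction y using Quot.ind with
  | mk p =>
    change Susp.pt g p.1 (0 + p.2) = Susp.mk g p.1 p.2
    rw [zero_add, Susp.pt_coe]

theorem continuous_flowMap (t : ℝ) : Continuous (flowMap g t) :=
  continuous_quot_lift _ ((Susp.continuous_pt g).comp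
    (continuous_fst.prodMk (continuous_const.add (continuous_subtype_val.comp continuous_snd))))

/-- The time `t` map `φ^t` of the suspension flow, as a homeomorphism of the suspension. -/
def flowHomeo (t : ℝ) : Susp g ≃ₜ Susp g where
  toFun := flowMap g t
  invFun := flowMap g (-t)
  left_inv y := by rw [← flowMap_add, neg_add_cancel, flowMap_zero]
  right_inv y := by rw [← flowMap_add, add_neg_cancel, flowMap_zero]
  continuous_toFun := continuous_flowMap g t
  continuous_invFun := continuous_flowMap g (-t)

end Suspension

/-! The almost one-to-one lift of a homeomorphism `f` of `Y` which blows up the orbit of a point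
`y₀`, using weights `a n` and a function `u`, of which only the values on `Y \ {y₀}` matter. -/

section Lift

variable {Y : Type*} [TopologicalSpace Y] (f : Y ≃ₜ Y) (y₀ : Y) (a : ℤ → ℝ) (u : Y → ℝ)

/-- The two-sided orbit of `y₀`. -/
def orbitPM : Set Y := {y | ∃ n : ℤ, y = (f ^ n) y₀}

/-- The function `u' = ∑ₙ aₙ (u ∘ fⁿ)`, summed over all integers `n`. -/
def liftFun (y : Y) : ℝ := ∑' n : ℤ, a n * u ((f ^ n) y)

/-- The graph of `u'` over the complement `Y'` of the orbit of `y₀`. -/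
def liftGraph : Set (Y × ℝ) := {p | p.1 ∉ orbitPM f y₀ ∧ p.2 = liftFun f a u p.1}

/-- The space `X`: the closure of the graph of `u'`. As `u'` has values in the closed interval
`[0,1]`, the closures in `Y × ℝ` and in `Y × [0,1]` agree. -/
def liftSpace : Set (Y × ℝ) := closure (liftGraph f y₀ a u)

/-- `h` extends the homeomorphism `(y, u' y) ↦ (f y, u' (f y))` of the graph of `u'`. -/
def IsLift (h : liftSpace f y₀ a u ≃ₜ liftSpace f y₀ a u) : Prop :=
  ∀ p : liftSpace f y₀ a u, (p : Y × ℝ) ∈ liftGraph f y₀ a u →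
    (h p : Y × ℝ) = (f (p : Y × ℝ).1, liftFun f a u (f (p : Y × ℝ).1))

end Lift

end SlovakConstruction

end

open SlovakConstruction

/-! Replace `X` by the closure `seqSpace` of the graph of `y ↦ (U (fⁿ y))ₙ` in `Y × [0,1]^ℤ`, where
`U` is `u` with the value `0` at `y₀`. Over any point of `Y` at most one coordinate is not
determined by continuity. Since `aₙ > 0`, the weighted sum recovers it, so `(y, v) ↦ (y, ∑ aₙ vₙ)`
is a homeomorphism onto `X` (`injOn_sumMap_seqSpace`). On `seqSpace` the lift of `f` is a shift.

The homeomorphisms are found from the path components. As `W` is totally disconnected, a path in `Y`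
stays on one flow line (`exists_flow_lift_of_path`). Above the flow line of `y₀` the fibre at each
time `iτ` is an arc: the curve reaches one of its end points from the left and oscillates against
all of it from the right. Hence that part of the space breaks into rays, the `i`-th lying over `((i
- 1)τ, iτ]`, and `closure C \ C` for the `i`-th ray `C` is the fibre at `(i - 1)τ`, a proper part of
the preceding ray (`joined_iff_of_mem_ray`, `closure_ray_diff`). Over any other flow line, `closure
C \ C` is a union of path components (`not_hasRayType_of_notMem_range`). So a homeomorphism permutes
the rays and respects their succession: it moves every fibre by the same number `m` of steps.
Composed with the `(-m)`-th power of the shift it preserves each fibre over a dense orbit, and is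
then the identity (`eq_one_of_seqProj_eq`).

Transitivity lifts from `Y` because every nonempty open set of `seqSpace` contains the full preimage
of a nonempty open set of `Y` (`exists_isOpen_preimage_seqProj_subset`). -/

namespace SlovakConstruction

/-! ### Topology of the suspension and paths in it. -/

section SuspensionTopology

variable {W : Type*} [TopologicalSpace W] (g : W ≃ₜ W)

instance [CompactSpace W] : CompactSpace (Susp g) :=
  inferInstanceAs (CompactSpace (Quot (Glue g)))

theorem Susp.exists_rep (y : Susp g) : ∃ (x : W) (s : unitInterval), y = Susp.mk g x s := by
  induction y using Quot.ind with
  | mk p => exact ⟨p.1, p.2, rfl⟩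

/-- The set of points `(x, s)` of the suspension with `x ∈ V` and `0 < s < 1`. -/
def Susp.box (V : Set W) : Set (Susp g) :=
  {y | Quot.lift (fun p : W × unitInterval => p.1 ∈ V ∧ (0 : ℝ) < p.2 ∧ (p.2 : ℝ) < 1) (by
    rintro ⟨x, s⟩ ⟨y, r⟩ ⟨hs, hr, -⟩
    dsimp only at hs hr
    simp [hs, hr]) y}

theorem Susp.mk_mem_box {V : Set W} {x : W} {s : unitInterval} :
    Susp.mk g x s ∈ Susp.box g V ↔ x ∈ V ∧ (0 : ℝ) < s ∧ (s : ℝ) < 1 := Iff.rfl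

theorem Susp.isOpen_box {V : Set W} (hV : IsOpen V) : IsOpen (Susp.box g V) := by
  have h : IsOpen {p : W × unitInterval | p.1 ∈ V ∧ (0 : ℝ) < p.2 ∧ (p.2 : ℝ) < 1} := by
    refine (hV.preimage continuous_fst).inter (IsOpen.inter ?_ ?_)
    · exact isOpen_lt continuous_const (continuous_subtype_val.comp continuous_snd)
    · exact isOpen_lt (continuous_subtype_val.comp continuous_snd) continuous_const
  -- A set is open in the quotient exactly when its preimage is, and that preimage is the set in
  -- `h`.
  exact h

theorem Susp.pt_half (x : W) :
    Susp.pt g x (1 / 2) = Susp.mk g x ⟨1 / 2, by norm_num, by norm_num⟩ :=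
  Susp.pt_coe g x ⟨1 / 2, by norm_num, by norm_num⟩

theorem Susp.pt_half_mem_box {V : Set W} {x : W} : Susp.pt g x (1 / 2) ∈ Susp.box g V ↔ x ∈ V := by
  rw [Susp.pt_half, Susp.mk_mem_box]
  norm_num

theorem Susp.pt_zero (x : W) : Susp.pt g x 0 = Susp.mk g x 0 := Susp.pt_coe g x 0

theorem flowMap_mk_zero (t : ℝ) (x : W) : flowMap g t (Susp.mk g x 0) = Susp.pt g x t := by
  rw [← Susp.pt_zero, flowMap_pt, add_zero]

/-- Flowing to height `1/2`, away from the seam, makes the `W`-coordinate visible through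
`Susp.box`. -/
theorem Susp.pt_injective (r : ℝ) : Function.Injective fun x => Susp.pt g x r := by
  intro x x' h
  have h2 := congrArg (flowMap g (1 / 2 - r)) h
  simp only [flowMap_pt, sub_add_cancel] at h2
  have h3 : Susp.pt g x (1 / 2) ∈ Susp.box g {x} := (Susp.pt_half_mem_box g).2 rfl
  rw [h2, Susp.pt_half_mem_box] at h3
  exact h3.symm

/-- The projection of the suspension onto the circle. -/
def Susp.angle : Susp g → AddCircle (1 : ℝ) :=
  Quot.lift (fun p : W × unitInterval => ((p.2 : ℝ) : AddCircle (1 : ℝ))) (by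
    rintro ⟨x, s⟩ ⟨y, r⟩ ⟨hs, hr, -⟩
    dsimp only at hs hr
    simp [hs, hr])

theorem Susp.continuous_angle : Continuous (Susp.angle g) :=
  continuous_quot_lift _
    ((AddCircle.continuous_mk' 1).comp (continuous_subtype_val.comp continuous_snd))

theorem _root_.AddCircle.coe_one_eq_coe_iff {r s : ℝ} :
    (r : AddCircle (1 : ℝ)) = s ↔ ∃ n : ℤ, s + n = r := by
  rw [← sub_eq_zero, ← AddCircle.coe_sub, AddCircle.coe_eq_zero_iff]
  refine exists_congr fun n => ?_
  rw [zsmul_eq_mul, mul_one, eq_sub_iff_add_eq, add_comm]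

theorem Susp.angle_pt (x : W) (r : ℝ) : Susp.angle g (Susp.pt g x r) = (r : AddCircle (1 : ℝ)) := by
  change ((Int.fract r : ℝ) : AddCircle (1 : ℝ)) = r
  exact AddCircle.coe_one_eq_coe_iff.2 ⟨-⌊r⌋, by rw [Int.fract]; push_cast; ring⟩

theorem Susp.exists_pt (y : Susp g) : ∃ (x : W) (r : ℝ), y = Susp.pt g x r := by
  obtain ⟨x, s, rfl⟩ := Susp.exists_rep g y
  exact ⟨x, s, (Susp.pt_coe g x s).symm⟩

theorem Susp.exists_pt_of_angle_eq {y : Susp g} {r : ℝ} (h : Susp.angle g y = r) :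
    ∃ x, y = Susp.pt g x r := by
  obtain ⟨x, s, rfl⟩ := Susp.exists_pt g y
  rw [Susp.angle_pt, AddCircle.coe_one_eq_coe_iff] at h
  obtain ⟨n, hn⟩ := h
  exact ⟨(g ^ n) x, by rw [← Susp.pt_add_int, hn]⟩

/-- Points with different angles are separated on the circle; points with the same angle are moved
by the flow to height `1/2` and separated there by boxes. -/
instance [T2Space W] : T2Space (Susp g) := by
  refine ⟨fun y y' hne => ?_⟩
  by_cases ha : Susp.angle g y = Susp.angle g y'
  · obtain ⟨x, r, rfl⟩ := Susp.exists_pt g y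
    rw [Susp.angle_pt] at ha
    obtain ⟨x', rfl⟩ := Susp.exists_pt_of_angle_eq g ha.symm
    have hx : x ≠ x' := fun h => hne (by rw [h])
    obtain ⟨V, V', hV, hV', hxV, hxV', hd⟩ := t2_separation hx
    have hc := continuous_flowMap g (1 / 2 - r)
    refine ⟨_, _, (Susp.isOpen_box g hV).preimage hc, (Susp.isOpen_box g hV').preimage hc,
      ?_, ?_, ?_⟩
    · simpa [flowMap_pt, -one_div] using (Susp.pt_half_mem_box g).2 hxV
    · simpa [flowMap_pt, -one_div] using (Susp.pt_half_mem_box g).2 hxV'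
    · refine Disjoint.preimage _ (disjoint_left.2 fun z hz hz' => ?_)
      obtain ⟨w, s, rfl⟩ := Susp.exists_rep g z
      rw [Susp.mk_mem_box] at hz hz'
      exact disjoint_left.1 hd hz.1 hz'.1
  · obtain ⟨V, V', hV, hV', h1, h2, hd⟩ := t2_separation ha
    exact ⟨_, _, hV.preimage (Susp.continuous_angle g), hV'.preimage (Susp.continuous_angle g),
      h1, h2, hd.preimage _⟩

/-- The product of a quotient map with the locally compact space `ℝ` is again a quotient map, so
continuity can be checked on `ℝ × (W × [0,1])`. -/
theorem continuous_flowMap_uncurry : Continuous fun p : ℝ × Susp g => flowMap g p.1 p.2 := by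
  have hq : IsQuotientMap (Quot.mk (Glue g)) := isQuotientMap_quot_mk
  refine hq.continuous_lift_prod_right (g := fun p : ℝ × Susp g => flowMap g p.1 p.2) ?_
  exact (Susp.continuous_pt g).comp (f := fun p : ℝ × (W × unitInterval) => (p.2.1, p.1 + p.2.2))
    ((continuous_fst.comp continuous_snd).prodMk
      (continuous_fst.add (continuous_subtype_val.comp (continuous_snd.comp continuous_snd))))

/-- A path in the suspension of a homeomorphism of a compact totally disconnected space stays on
one orbit of the flow, along which it moves continuously. -/
theorem exists_flow_lift_of_path [CompactSpace W] [T2Space W] [TotallyDisconnectedSpace W]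
    (γ : C(unitInterval, Susp g)) :
    ∃ θ : C(unitInterval, ℝ), θ 0 = 0 ∧ ∀ s, γ s = flowMap g (θ s) (γ 0) := by
  obtain ⟨x, r, hxr⟩ := Susp.exists_pt g (γ 0)
  let c : C(unitInterval, AddCircle (1 : ℝ)) := ⟨fun s => Susp.angle g (γ s),
    (Susp.continuous_angle g).comp γ.continuous⟩
  -- Lifting the angle to `ℝ` gives the flow time; undoing it pushes the path into the cross-section
  -- `W × {0}`, a copy of `W`, where it must be constant.
  obtain ⟨θ, hθ, hθ0⟩ := (AddCircle.isCoveringMap_coe (1 : ℝ)).exists_path_lifts c r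
    (by simp [c, hxr, Susp.angle_pt])
  have hθ' : ∀ s, ((θ s : ℝ) : AddCircle (1 : ℝ)) = Susp.angle g (γ s) := fun s => congrFun hθ s
  choose w hw using fun s => Susp.exists_pt_of_angle_eq g (hθ' s).symm
  have hw' : ∀ s, Susp.pt g (w s) 0 = flowMap g (-θ s) (γ s) := by
    intro s
    rw [hw s, flowMap_pt, neg_add_cancel]
  have hemb : IsClosedEmbedding fun z => Susp.pt g z 0 :=
    (Continuous.isClosedEmbedding
      ((Susp.continuous_pt g).comp (continuous_id.prodMk continuous_const))
      (Susp.pt_injective g 0))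
  have hwc : Continuous w := by
    rw [hemb.isInducing.continuous_iff]
    have : ((fun z => Susp.pt g z 0) ∘ w) = fun s => flowMap g (-θ s) (γ s) := funext hw'
    rw [this]
    exact (continuous_flowMap_uncurry g).comp ((θ.continuous.neg).prodMk γ.continuous)
  have hconst : ∀ s, w s = w 0 := by
    intro s
    exact (isPreconnected_univ.image w hwc.continuousOn).subsingleton ⟨s, mem_univ _, rfl⟩
      ⟨0, mem_univ _, rfl⟩
  refine ⟨⟨fun s => θ s - r, by fun_prop⟩, by simp [hθ0], fun s => ?_⟩
  change γ s = flowMap g (θ s - r) (γ 0)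
  rw [hw s, hconst s, hw 0, hθ0, flowMap_pt, sub_add_cancel]

/-- Equal angles force the two times to differ by an integer `n`, and then `g ^ n` fixes `x`. -/
theorem Susp.pt_left_injective [T1Space W] {x : W} (hx : ∀ n : ℤ, n ≠ 0 → (g ^ n) x ≠ x) :
    Function.Injective (Susp.pt g x) := by
  intro r r' h
  have ha := congrArg (Susp.angle g) h
  rw [Susp.angle_pt, Susp.angle_pt, AddCircle.coe_one_eq_coe_iff] at ha
  obtain ⟨n, hn⟩ := ha
  rw [← hn, Susp.pt_add_int] at h
  by_cases h0 : n = 0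
  · simpa [h0] using hn.symm
  · exact absurd (Susp.pt_injective g r' h) (hx n h0)

/-- If `g ^ n` fixed `x`, the dense forward orbit would be `{x}` and `W` a single point, which is
not perfect. -/
theorem zpow_apply_ne_of_isTransPt [T1Space W] [PerfectSpace W] {x : W}
    (hx : ∀ n : ℤ, n ≠ 0 → IsTransPt (g ^ n) x) (n : ℤ) (hn : n ≠ 0) : (g ^ n) x ≠ x := by
  intro h
  have hsub : {y : W | ∃ k : ℕ, 1 ≤ k ∧ y = ((g ^ n) ^ k) x} ⊆ {x} := by
    rintro y ⟨k, -, rfl⟩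
    induction k with
    | zero => rfl
    | succ k ih =>
      rw [pow_succ]
      change ((g ^ n) ^ k) ((g ^ n) x) ∈ _
      rwa [h]
  have huniv := hx n hn
  have h1 : ({x} : Set W) = univ :=
    univ_subset_iff.1 (huniv ▸ closure_minimal hsub isClosed_singleton)
  have hacc := PerfectSpace.univ_preperfect x (mem_univ x)
  have : (𝓝[≠] x).NeBot := by simpa [AccPt] using hacc
  rw [compl_eq_univ_sdiff, ← h1] at this
  simp at this
  exact this.ne rfl

theorem flowHomeo_zpow (t : ℝ) (n : ℤ) : flowHomeo g t ^ n = flowHomeo g (n * t) := by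
  have hmul : ∀ r s : ℝ, flowHomeo g r * flowHomeo g s = flowHomeo g (r + s) := fun r s =>
    Homeomorph.ext fun y => (flowMap_add g r s y).symm
  have hone : flowHomeo g 0 = 1 := Homeomorph.ext fun y => flowMap_zero g y
  have hinv : (flowHomeo g t)⁻¹ = flowHomeo g (-t) := by
    rw [inv_eq_iff_mul_eq_one, hmul, add_neg_cancel, hone]
  induction n with
  | zero => simp [hone]
  | succ k ih => rw [zpow_add_one, ih, hmul]; congr 1; push_cast; ring
  | pred k ih => rw [zpow_sub_one, ih, hinv, hmul]; congr 1; push_cast; ring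

end SuspensionTopology


/-! ### The extension of `f` by sequences: fibres, irreducibility, transitivity. -/

section Extension

variable {Y : Type*} [TopologicalSpace Y] (f : Y ≃ₜ Y) (y₀ : Y) (U : Y → unitInterval)

/-- The graph, over the complement of the orbit of `y₀`, of the sequence `(U (fⁿ y))ₙ`. -/
def seqGraph : Set (Y × (ℤ → unitInterval)) :=
  (fun y => (y, fun n => U ((f ^ n) y))) '' (orbitPM f y₀)ᶜ

/-- The closure of the graph of `y ↦ (U (fⁿ y))ₙ`. -/
def seqSpace : Set (Y × (ℤ → unitInterval)) := closure (seqGraph f y₀ U)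

theorem zpow_apply_mem_orbitPM_iff (n : ℤ) (y : Y) :
    (f ^ n) y ∈ orbitPM f y₀ ↔ y ∈ orbitPM f y₀ := by
  constructor
  · rintro ⟨m, hm⟩
    refine ⟨-n + m, ?_⟩
    rw [zpow_add]
    change y = (f ^ (-n)) ((f ^ m) y₀)
    rw [← hm]
    change y = (f ^ (-n) * f ^ n) y
    rw [← zpow_add, neg_add_cancel, zpow_zero]
    rfl
  · rintro ⟨m, rfl⟩
    exact ⟨n + m, by rw [zpow_add]; rfl⟩

theorem apply_mem_orbitPM_iff (y : Y) : f y ∈ orbitPM f y₀ ↔ y ∈ orbitPM f y₀ := by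
  simpa using zpow_apply_mem_orbitPM_iff f y₀ 1 y

theorem self_mem_orbitPM : y₀ ∈ orbitPM f y₀ := ⟨0, rfl⟩

theorem zpow_apply_ne_of_notMem_orbitPM {y : Y} (hy : y ∉ orbitPM f y₀) (n : ℤ) :
    (f ^ n) y ≠ y₀ := fun h =>
  hy ((zpow_apply_mem_orbitPM_iff f y₀ n y).1 (h ▸ self_mem_orbitPM f y₀))

variable {f y₀ U}

/-- Both sides are limits along the graph, where they agree, since `U` is continuous at `(f ^ n)
z.1`. -/
theorem seqSpace_snd_apply [T1Space Y] (hU : ContinuousOn U {y₀}ᶜ)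
    {z : Y × (ℤ → unitInterval)} (hz : z ∈ seqSpace f y₀ U) {n : ℤ} (hn : (f ^ n) z.1 ≠ y₀) :
    z.2 n = U ((f ^ n) z.1) := by
  have hne : (𝓝[seqGraph f y₀ U] z).NeBot := mem_closure_iff_nhdsWithin_neBot.1 hz
  have h1 : Tendsto (fun p : Y × (ℤ → unitInterval) => p.2 n) (𝓝[seqGraph f y₀ U] z)
      (𝓝 (z.2 n)) :=
    ((continuous_apply n).comp continuous_snd).continuousWithinAt
  have h2 : ContinuousAt (fun p : Y × (ℤ → unitInterval) => U ((f ^ n) p.1)) z :=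
    ContinuousAt.comp (f := fun p : Y × (ℤ → unitInterval) => (f ^ n) p.1)
      (hU.continuousAt (isOpen_compl_singleton.mem_nhds hn))
      ((f ^ n).continuous.comp continuous_fst).continuousAt
  refine tendsto_nhds_unique h1 ((h2.mono_left nhdsWithin_le_nhds).congr' ?_)
  filter_upwards [self_mem_nhdsWithin] with p hp
  obtain ⟨y, -, rfl⟩ := hp
  rfl

theorem eq_of_mem_seqSpace [T1Space Y] (hU : ContinuousOn U {y₀}ᶜ)
    {z : Y × (ℤ → unitInterval)} (hz : z ∈ seqSpace f y₀ U) (h : z.1 ∉ orbitPM f y₀) :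
    z = (z.1, fun n => U ((f ^ n) z.1)) :=
  Prod.ext rfl (funext fun n =>
    seqSpace_snd_apply hU hz (zpow_apply_ne_of_notMem_orbitPM f y₀ h n))

variable (f y₀ U)

/-- The homeomorphism `(y, v) ↦ (f y, (v (n + 1))ₙ)` of `Y × [0,1]^ℤ`. -/
def prodShift : (Y × (ℤ → unitInterval)) ≃ₜ (Y × (ℤ → unitInterval)) where
  toFun z := (f z.1, fun n => z.2 (n + 1))
  invFun z := (f.symm z.1, fun n => z.2 (n - 1))
  left_inv z := by simp
  right_inv z := by simp
  continuous_toFun := by fun_prop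
  continuous_invFun := by fun_prop

theorem image_prodShift_seqGraph : prodShift f '' seqGraph f y₀ U = seqGraph f y₀ U := by
  have key : ∀ y, prodShift f (y, fun n => U ((f ^ n) y)) = (f y, fun n => U ((f ^ n) (f y))) := by
    intro y
    refine Prod.ext rfl (funext fun n => ?_)
    change U ((f ^ (n + 1)) y) = _
    rw [zpow_add_one]
    rfl
  ext z
  constructor
  · rintro ⟨_, ⟨y, hy, rfl⟩, rfl⟩
    exact ⟨f y, fun h => hy ((apply_mem_orbitPM_iff f y₀ y).1 h), (key y).symm⟩
  · rintro ⟨y, hy, rfl⟩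
    refine ⟨_, ⟨f.symm y, fun h => hy ?_, rfl⟩, by simp [key]⟩
    simpa using (apply_mem_orbitPM_iff f y₀ (f.symm y)).2 h

theorem prodShift_mem_seqSpace_iff (z : Y × (ℤ → unitInterval)) :
    z ∈ seqSpace f y₀ U ↔ prodShift f z ∈ seqSpace f y₀ U := by
  have : prodShift f '' seqSpace f y₀ U = seqSpace f y₀ U := by
    rw [seqSpace, (prodShift f).image_closure, image_prodShift_seqGraph]
  conv_rhs => rw [← this]
  exact ((prodShift f).injective.mem_set_image).symm

/-- The homeomorphism `(y, v) ↦ (f y, (v (n + 1))ₙ)` of the space `seqSpace`. -/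
def seqShift : seqSpace f y₀ U ≃ₜ seqSpace f y₀ U :=
  (prodShift f).subtype (prodShift_mem_seqSpace_iff f y₀ U)

/-- The projection of `seqSpace` onto `Y`. -/
def seqProj (z : seqSpace f y₀ U) : Y := (z : Y × (ℤ → unitInterval)).1

theorem continuous_seqProj : Continuous (seqProj f y₀ U) :=
  continuous_fst.comp continuous_subtype_val

theorem seqProj_seqShift_zpow (n : ℤ) (z : seqSpace f y₀ U) :
    seqProj f y₀ U ((seqShift f y₀ U ^ n) z) = (f ^ n) (seqProj f y₀ U z) := by
  have h1 : ∀ z, seqProj f y₀ U (seqShift f y₀ U z) = f (seqProj f y₀ U z) := fun _ => rfl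
  have h2 : ∀ z, seqProj f y₀ U ((seqShift f y₀ U)⁻¹ z) = f⁻¹ (seqProj f y₀ U z) := fun _ => rfl
  induction n generalizing z with
  | zero => rfl
  | succ k ih =>
    rw [zpow_add_one, zpow_add_one]
    change seqProj f y₀ U ((seqShift f y₀ U ^ (k : ℤ)) (seqShift f y₀ U z)) = _
    rw [ih, h1]
    rfl
  | pred k ih =>
    rw [zpow_sub_one, zpow_sub_one]
    change seqProj f y₀ U ((seqShift f y₀ U ^ (-(k : ℤ))) ((seqShift f y₀ U)⁻¹ z)) = _
    rw [ih, h2]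
    rfl

instance [CompactSpace Y] : CompactSpace (seqSpace f y₀ U) :=
  isCompact_iff_compactSpace.1 isClosed_closure.isCompact

theorem mem_seqSpace_of_notMem {y : Y} (hy : y ∉ orbitPM f y₀) :
    (y, fun n => U ((f ^ n) y)) ∈ seqSpace f y₀ U := subset_closure ⟨y, hy, rfl⟩

theorem isClosedMap_seqProj [CompactSpace Y] [T2Space Y] : IsClosedMap (seqProj f y₀ U) :=
  (continuous_seqProj f y₀ U).isClosedMap

theorem seqProj_surjective [CompactSpace Y] [T2Space Y] (hd : Dense (orbitPM f y₀)ᶜ) :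
    Function.Surjective (seqProj f y₀ U) := by
  have hcl := (isClosedMap_seqProj f y₀ U).isClosed_range
  rw [← range_eq_univ, ← univ_subset_iff, ← hd.closure_eq]
  refine closure_minimal (fun y hy => ?_) hcl
  exact ⟨⟨_, mem_seqSpace_of_notMem f y₀ U hy⟩, rfl⟩

theorem dense_notMem_orbitPM : Dense {z : seqSpace f y₀ U | seqProj f y₀ U z ∉ orbitPM f y₀} := by
  intro z
  rw [closure_subtype]
  refine closure_mono ?_ z.2
  rintro _ ⟨y, hy, rfl⟩
  exact ⟨⟨_, mem_seqSpace_of_notMem f y₀ U hy⟩, hy, rfl⟩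

variable {f y₀ U}

theorem seqProj_injOn [T1Space Y] (hU : ContinuousOn U {y₀}ᶜ) {z z' : seqSpace f y₀ U}
    (hz : seqProj f y₀ U z ∉ orbitPM f y₀) (h : seqProj f y₀ U z = seqProj f y₀ U z') :
    z = z' := by
  have h1 := eq_of_mem_seqSpace hU z.2 hz
  have h2 := eq_of_mem_seqSpace hU z'.2 (show seqProj f y₀ U z' ∉ _ from h ▸ hz)
  apply Subtype.ext
  rw [h1, h2]
  simp only [seqProj] at h
  rw [h]

/-- Irreducibility of the projection. The complement of the closed image of `Aᶜ` works: it is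
nonempty because `A` contains a point that is alone in its fibre. -/
theorem exists_isOpen_preimage_seqProj_subset [CompactSpace Y] [T2Space Y]
    (hU : ContinuousOn U {y₀}ᶜ) {A : Set (seqSpace f y₀ U)} (hA : IsOpen A) (hne : A.Nonempty) :
    ∃ V : Set Y, IsOpen V ∧ V.Nonempty ∧ seqProj f y₀ U ⁻¹' V ⊆ A := by
  obtain ⟨z, hzA, hz⟩ := (dense_notMem_orbitPM f y₀ U).inter_open_nonempty A hA hne
  refine ⟨(seqProj f y₀ U '' Aᶜ)ᶜ, ((isClosedMap_seqProj f y₀ U) _ hA.isClosed_compl).isOpen_compl,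
    ⟨seqProj f y₀ U z, ?_⟩, ?_⟩
  · rintro ⟨z', hz', h⟩
    exact hz' (seqProj_injOn hU hz h.symm ▸ hzA)
  · intro z' hz'
    by_contra h
    exact hz' ⟨z', h, rfl⟩

/-- A homeomorphism of `seqSpace` which preserves each fibre over a dense orbit of `y₀` is the
identity. -/
theorem eq_one_of_seqProj_eq [CompactSpace Y] [T2Space Y] (hU : ContinuousOn U {y₀}ᶜ)
    (hd : Dense (orbitPM f y₀)ᶜ) (ho : Dense (orbitPM f y₀)) (k : seqSpace f y₀ U ≃ₜ seqSpace f y₀ U)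
    (hk : ∀ z, seqProj f y₀ U z ∈ orbitPM f y₀ → seqProj f y₀ U (k z) = seqProj f y₀ U z) :
    k = 1 := by
  -- By irreducibility the preimage of a dense set is dense, so `k` covers the identity of `Y`
  -- everywhere; it then fixes the dense set of points alone in their fibres.
  have h1 : Dense (seqProj f y₀ U ⁻¹' orbitPM f y₀) := by
    rw [dense_iff_inter_open]
    intro A hA hne
    obtain ⟨V, hV, hVne, hVA⟩ := exists_isOpen_preimage_seqProj_subset hU hA hne
    obtain ⟨y, hyV, hy⟩ := ho.inter_open_nonempty V hV hVne
    obtain ⟨z, rfl⟩ := seqProj_surjective f y₀ U hd y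
    exact ⟨z, hVA hyV, hy⟩
  have h2 : seqProj f y₀ U ∘ k = seqProj f y₀ U :=
    Continuous.ext_on h1 ((continuous_seqProj f y₀ U).comp k.continuous)
      (continuous_seqProj f y₀ U) hk
  have h3 : (k : seqSpace f y₀ U → seqSpace f y₀ U) = id :=
    Continuous.ext_on (dense_notMem_orbitPM f y₀ U) k.continuous continuous_id fun z hz =>
      (seqProj_injOn hU hz (congrFun h2 z).symm).symm
  exact Homeomorph.ext (congrFun h3)

theorem topTransitive_seqShift_zpow [CompactSpace Y] [T2Space Y] (hU : ContinuousOn U {y₀}ᶜ)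
    (hd : Dense (orbitPM f y₀)ᶜ) {n : ℤ} (ht : TopTransitive (f ^ n)) :
    TopTransitive (seqShift f y₀ U ^ n) := by
  intro A B hA hAne hB hBne
  obtain ⟨V, hV, hVne, hVA⟩ := exists_isOpen_preimage_seqProj_subset hU hA hAne
  obtain ⟨V', hV', hVne', hVB⟩ := exists_isOpen_preimage_seqProj_subset hU hB hBne
  obtain ⟨m, hm, _, ⟨y, hy, rfl⟩, hy'⟩ := ht V V' hV hVne hV' hVne'
  obtain ⟨z, rfl⟩ := seqProj_surjective f y₀ U hd y
  refine ⟨m, hm, _, ⟨z, hVA hy, rfl⟩, hVB ?_⟩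
  rw [mem_preimage, ← zpow_natCast, ← zpow_mul, seqProj_seqShift_zpow, zpow_mul, zpow_natCast]
  exact hy'

/-- The orbit of `y` visits every nonempty open set infinitely often, so a visit to the first set is
followed by a strictly later visit to the second. -/
theorem topTransitive_of_omegaPt_eq_univ {k : Y ≃ₜ Y} {y : Y} (h : omegaPt k y = univ) :
    TopTransitive k := by
  have hfr : ∀ V : Set Y, IsOpen V → V.Nonempty → ∃ᶠ n : ℕ in atTop, (k ^ n) y ∈ V := by
    rintro V hV ⟨v, hv⟩
    have hv' : v ∈ omegaPt k y := h ▸ mem_univ v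
    rw [omegaPt, mem_omegaLimit_singleton_iff_mapClusterPt, mapClusterPt_iff_frequently] at hv'
    exact hv' V (hV.mem_nhds hv)
  intro A B hA hAne hB hBne
  obtain ⟨m, hm⟩ := (hfr A hA hAne).exists
  obtain ⟨n, hn, hnB⟩ := (frequently_atTop.1 (hfr B hB hBne)) (m + 1)
  refine ⟨n - m, by lia, (k ^ n) y, ⟨(k ^ m) y, hm, ?_⟩, hnB⟩
  change (k ^ (n - m) * k ^ m) y = _
  rw [← pow_add, Nat.sub_add_cancel (by lia)]

end Extension


/-! ### Transport of homeomorphism groups and transitivity by conjugation. -/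

section Conjugation

variable {X X' : Type*} [TopologicalSpace X] [TopologicalSpace X']

/-- Conjugation by a homeomorphism, as an isomorphism of homeomorphism groups. -/
def conjHomeo (e : X ≃ₜ X') : (X ≃ₜ X) ≃* (X' ≃ₜ X') where
  toFun k := (e.symm.trans k).trans e
  invFun k := (e.trans k).trans e.symm
  left_inv k := by ext; simp
  right_inv k := by ext; simp
  map_mul' k l := by
    refine Homeomorph.ext fun x => ?_
    change e (k (l (e.symm x))) = e (k (e.symm (e (l (e.symm x)))))
    rw [e.symm_apply_apply]

theorem conjHomeo_apply_apply (e : X ≃ₜ X') (k : X ≃ₜ X) (x : X) :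
    conjHomeo e k (e x) = e (k x) := by
  change e (k (e.symm (e x))) = _
  rw [e.symm_apply_apply]

theorem TopTransitive.conjHomeo {k : X ≃ₜ X} (hk : TopTransitive k) (e : X ≃ₜ X') :
    TopTransitive (conjHomeo e k) := by
  intro A B hA hAne hB hBne
  obtain ⟨n, hn, _, ⟨x, hx, rfl⟩, hx'⟩ := hk (e ⁻¹' A) (e ⁻¹' B) (hA.preimage e.continuous)
    (hAne.preimage e.surjective) (hB.preimage e.continuous) (hBne.preimage e.surjective)
  refine ⟨n, hn, _, ⟨e x, hx, rfl⟩, ?_⟩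
  rw [← map_pow, conjHomeo_apply_apply]
  exact hx'

end Conjugation

/-! ### From sequences to weighted sums. -/

section Weights

variable {Y : Type*} [TopologicalSpace Y] {f : Y ≃ₜ Y} {y₀ : Y} {a : ℤ → ℝ} {u : Y → ℝ}
  {U : Y → unitInterval}

/-- The map `(y, v) ↦ (y, ∑ₙ aₙ vₙ)`. -/
noncomputable def sumMap (a : ℤ → ℝ) (z : Y × (ℤ → unitInterval)) : Y × ℝ :=
  (z.1, ∑' n : ℤ, a n * z.2 n)

theorem norm_mul_unitInterval_le {c : ℝ} (hc : 0 < c) (s : unitInterval) : ‖c * s‖ ≤ c := by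
  rw [Real.norm_of_nonneg (mul_nonneg hc.le s.2.1)]
  exact mul_le_of_le_one_right hc.le s.2.2

theorem summable_mul_unitInterval (ha : ∀ n, 0 < a n) (hs : Summable a) (v : ℤ → unitInterval) :
    Summable fun n => a n * (v n : ℝ) :=
  hs.of_norm_bounded fun n => norm_mul_unitInterval_le (ha n) (v n)

theorem continuous_sumMap (ha : ∀ n, 0 < a n) (hs : Summable a) :
    Continuous (sumMap a : Y × (ℤ → unitInterval) → Y × ℝ) :=
  continuous_fst.prodMk (continuous_tsum (fun n => by fun_prop) hs fun n z =>
    norm_mul_unitInterval_le (ha n) (z.2 n))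

theorem sumMap_seq (hUu : ∀ y, y ≠ y₀ → (U y : ℝ) = u y) {y : Y} (hy : y ∉ orbitPM f y₀) :
    sumMap a (y, fun n => U ((f ^ n) y)) = (y, liftFun f a u y) := by
  refine Prod.ext rfl (tsum_congr fun n => ?_)
  rw [hUu _ (zpow_apply_ne_of_notMem_orbitPM f y₀ hy n)]

theorem image_sumMap_seqGraph (hUu : ∀ y, y ≠ y₀ → (U y : ℝ) = u y) :
    sumMap a '' seqGraph f y₀ U = liftGraph f y₀ a u := by
  ext p
  constructor
  · rintro ⟨_, ⟨y, hy, rfl⟩, rfl⟩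
    simp only [sumMap_seq hUu hy]
    exact ⟨hy, rfl⟩
  · rintro ⟨hy, hp⟩
    exact ⟨_, ⟨p.1, hy, rfl⟩, (sumMap_seq hUu hy).trans (Prod.ext rfl hp.symm)⟩

/-- By compactness the image of the closure of the graph is the closure of its image. -/
theorem image_sumMap_seqSpace [CompactSpace Y] [T2Space Y] (ha : ∀ n, 0 < a n) (hs : Summable a)
    (hUu : ∀ y, y ≠ y₀ → (U y : ℝ) = u y) :
    sumMap a '' seqSpace f y₀ U = liftSpace f y₀ a u := by
  rw [seqSpace, image_closure_of_isCompact isClosed_closure.isCompact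
    (continuous_sumMap ha hs).continuousOn, image_sumMap_seqGraph hUu, liftSpace]

/-- As `y₀` is not periodic, `(f ^ m) y = y₀` for at most one `m`. All other coordinates are
determined by `y`, and the `m`-th is then read off from the sum because `a m ≠ 0`. -/
theorem injOn_sumMap_seqSpace [T1Space Y] (ha : ∀ n, 0 < a n) (hs : Summable a)
    (hU : ContinuousOn U {y₀}ᶜ) (hinj : Function.Injective fun n : ℤ => (f ^ n) y₀) :
    InjOn (sumMap a) (seqSpace f y₀ U) := by
  rintro ⟨y, v⟩ hz ⟨y', v'⟩ hz' h
  obtain rfl : y = y' := congrArg Prod.fst h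
  refine Prod.ext rfl (funext fun m => ?_)
  have hne : ∀ n, (f ^ n) y ≠ y₀ → v n = v' n := fun n hn =>
    (seqSpace_snd_apply hU hz hn).trans (seqSpace_snd_apply hU hz' hn).symm
  by_cases hm : (f ^ m) y = y₀
  · have hne' : ∀ n, n ≠ m → v n = v' n := by
      intro n hn
      refine hne n fun h0 => hn ?_
      have hy : (f ^ (-m)) y₀ = y := by
        rw [← hm]
        change (f ^ (-m) * f ^ m) y = y
        rw [← zpow_add, neg_add_cancel]
        rfl
      have h1 : (f ^ (n + -m)) y₀ = (f ^ (0 : ℤ)) y₀ := by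
        rw [zpow_add]
        change (f ^ n) ((f ^ (-m)) y₀) = y₀
        rw [hy, h0]
      have h2 : n + -m = 0 := hinj h1
      lia
    have hsum : ∑' n : ℤ, a n * (v n : ℝ) = ∑' n : ℤ, a n * (v' n : ℝ) := congrArg Prod.snd h
    rw [(summable_mul_unitInterval ha hs v).tsum_eq_add_tsum_ite m,
      (summable_mul_unitInterval ha hs v').tsum_eq_add_tsum_ite m] at hsum
    have hrest : (∑' n : ℤ, if n = m then 0 else a n * (v n : ℝ)) =
        ∑' n : ℤ, if n = m then 0 else a n * (v' n : ℝ) := by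
      refine tsum_congr fun n => ?_
      split_ifs with hn
      · rfl
      · rw [hne' n hn]
    rw [hrest] at hsum
    exact Subtype.ext (mul_left_cancel₀ (ha m).ne' (add_right_cancel hsum))
  · exact hne m hm

/-- The homeomorphism `(y, v) ↦ (y, ∑ₙ aₙ vₙ)` of `seqSpace` onto `liftSpace`. -/
noncomputable def seqSpaceHomeo [CompactSpace Y] [T2Space Y] (ha : ∀ n, 0 < a n) (hs : Summable a)
    (hUu : ∀ y, y ≠ y₀ → (U y : ℝ) = u y)
    (hU : ContinuousOn U {y₀}ᶜ) (hinj : Function.Injective fun n : ℤ => (f ^ n) y₀) :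
    seqSpace f y₀ U ≃ₜ liftSpace f y₀ a u :=
  Continuous.homeoOfEquivCompactToT2
    (f := BijOn.equiv (sumMap a) ⟨fun _ hz => image_sumMap_seqSpace ha hs hUu ▸ ⟨_, hz, rfl⟩,
      injOn_sumMap_seqSpace ha hs hU hinj, (image_sumMap_seqSpace ha hs hUu).ge⟩)
    (((continuous_sumMap ha hs).comp continuous_subtype_val).subtype_mk _)

theorem dense_liftGraph : Dense {p : liftSpace f y₀ a u | (p : Y × ℝ) ∈ liftGraph f y₀ a u} := by
  intro p
  rw [closure_subtype]
  refine closure_mono ?_ p.2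
  intro q hq
  exact ⟨⟨q, subset_closure hq⟩, hq, rfl⟩

theorem IsLift.unique [T2Space Y] {h h' : liftSpace f y₀ a u ≃ₜ liftSpace f y₀ a u}
    (hh : IsLift f y₀ a u h) (hh' : IsLift f y₀ a u h') : h = h' :=
  Homeomorph.ext <| congrFun <| Continuous.ext_on dense_liftGraph h.continuous h'.continuous
    fun p hp => Subtype.ext ((hh p hp).trans (hh' p hp).symm)

theorem isLift_conjHomeo_seqShift [CompactSpace Y] [T2Space Y] (ha : ∀ n, 0 < a n)
    (hs : Summable a) (hUu : ∀ y, y ≠ y₀ → (U y : ℝ) = u y) (hU : ContinuousOn U {y₀}ᶜ)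
    (hinj : Function.Injective fun n : ℤ => (f ^ n) y₀) :
    IsLift f y₀ a u (conjHomeo (seqSpaceHomeo ha hs hUu hU hinj) (seqShift f y₀ U)) := by
  rintro p ⟨hy, hp⟩
  have he : p = seqSpaceHomeo ha hs hUu hU hinj
      ⟨_, mem_seqSpace_of_notMem f y₀ U hy⟩ :=
    Subtype.ext ((Prod.ext rfl hp : (p : Y × ℝ) = (p.1.1, liftFun f a u p.1.1)).trans
      (sumMap_seq hUu hy).symm)
  have hy' : f p.1.1 ∉ orbitPM f y₀ := fun h => hy ((apply_mem_orbitPM_iff f y₀ _).1 h)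
  rw [← sumMap_seq (a := a) hUu hy']
  conv_lhs => rw [he, conjHomeo_apply_apply]
  change sumMap a (prodShift f _) = _
  congr 1
  refine Prod.ext rfl (funext fun n => ?_)
  change U ((f ^ (n + 1)) p.1.1) = _
  rw [zpow_add_one]
  rfl

theorem existsUnique_isLift_and_of_seqShift [CompactSpace Y] [T2Space Y] (ha : ∀ n, 0 < a n)
    (hs : Summable a) (hUu : ∀ y, y ≠ y₀ → (U y : ℝ) = u y) (hU : ContinuousOn U {y₀}ᶜ)
    (hinj : Function.Injective fun n : ℤ => (f ^ n) y₀)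
    (hk : ∀ k : seqSpace f y₀ U ≃ₜ seqSpace f y₀ U, ∃ n : ℤ, k = seqShift f y₀ U ^ n)
    (ht : ∀ n : ℤ, n ≠ 0 → TopTransitive (seqShift f y₀ U ^ n)) :
    (∃! h : liftSpace f y₀ a u ≃ₜ liftSpace f y₀ a u, IsLift f y₀ a u h) ∧
    ∀ h : liftSpace f y₀ a u ≃ₜ liftSpace f y₀ a u, IsLift f y₀ a u h →
      (univ : Set (liftSpace f y₀ a u ≃ₜ liftSpace f y₀ a u)) = {k | ∃ n : ℤ, k = h ^ n} ∧
        ∀ n : ℤ, n ≠ 0 → TopTransitive (h ^ n) := by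
  have h0 := isLift_conjHomeo_seqShift ha hs hUu hU hinj
  set e := seqSpaceHomeo ha hs hUu hU hinj
  refine ⟨⟨_, h0, fun h hh => hh.unique h0⟩, fun h hh => ?_⟩
  obtain rfl := hh.unique h0
  refine ⟨(eq_univ_of_forall fun k => ?_).symm, fun n hn => ?_⟩
  · obtain ⟨n, hn⟩ := hk ((conjHomeo e).symm k)
    exact ⟨n, by rw [← map_zpow, ← hn, MulEquiv.apply_symm_apply]⟩
  · rw [← map_zpow]
    exact (ht n hn).conjHomeo e

end Weights


/-! ### The space over the flow line of `(x₀, 0)`: arcs and oscillating curves. -/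

section SineCurve

variable {W : Type*} [TopologicalSpace W] {g : W ≃ₜ W} {x₀ : W} {τ : ℝ}
  {U : Susp g → unitInterval}

/-- `U` is continuous off the point `(x₀, 0)`; along the orbit of this point, which is not
periodic, it vanishes on the left and oscillates like a topologist's sine curve on the right. -/
structure IsSineCut (g : W ≃ₜ W) (x₀ : W) (U : Susp g → unitInterval) : Prop where
  continuousOn : ContinuousOn U {Susp.mk g x₀ 0}ᶜ
  -- The value at `t = 0` is a convention; taking it to be `0` makes `U` left continuous along the
  -- flow line.
  eq_zero : ∀ t : ℝ, -(1 / 2) ≤ t → t ≤ 0 → U (Susp.pt g x₀ t) = 0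
  eq_cos : ∀ t : ℝ, 0 < t → t ≤ 1 / 2 →
    (U (Susp.pt g x₀ t) : ℝ) = 1 / 2 * (1 - Real.cos (Real.pi / t))
  injective : Function.Injective (Susp.pt g x₀)

theorem continuous_pt_right (x : W) : Continuous (Susp.pt g x) :=
  (Susp.continuous_pt g).comp (continuous_const.prodMk continuous_id)

namespace IsSineCut

theorem pt_ne (hU : IsSineCut g x₀ U) {t : ℝ} (ht : t ≠ 0) : Susp.pt g x₀ t ≠ Susp.mk g x₀ 0 :=
  fun h => ht (hU.injective (h.trans (Susp.pt_zero g x₀).symm))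

theorem continuousAt_comp_pt [T1Space (Susp g)] (hU : IsSineCut g x₀ U) {t : ℝ} (ht : t ≠ 0) :
    ContinuousAt (fun t => U (Susp.pt g x₀ t)) t :=
  ContinuousAt.comp (hU.continuousOn.continuousAt (isOpen_compl_singleton.mem_nhds (hU.pt_ne ht)))
    (continuous_pt_right x₀).continuousAt

theorem continuousWithinAt_comp_pt [T1Space (Susp g)] (hU : IsSineCut g x₀ U) (t : ℝ) :
    ContinuousWithinAt (fun t => U (Susp.pt g x₀ t)) (Iic t) t := by
  by_cases ht : t = 0
  · subst ht
    refine (continuousWithinAt_const (b := (0 : unitInterval))).congr_of_eventuallyEq ?_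
      (hU.eq_zero 0 (by norm_num) le_rfl)
    have hlt : -(1 / 2 : ℝ) < 0 := by norm_num
    filter_upwards [self_mem_nhdsWithin, mem_nhdsWithin_of_mem_nhds (Ioi_mem_nhds hlt)]
      with t h1 h2
    exact hU.eq_zero t (le_of_lt h2) h1
  · exact (hU.continuousAt_comp_pt ht).continuousWithinAt

theorem exists_seq_eq (hU : IsSineCut g x₀ U) (s : unitInterval) {ε : ℝ} (hε : 0 < ε) :
    ∃ t : ℕ → ℝ, Tendsto t atTop (𝓝 0) ∧ ∀ k, 0 < t k ∧ t k < ε ∧ U (Susp.pt g x₀ (t k)) = s := by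
  have hpi := Real.pi_pos
  -- These are solutions of `(1 - cos (π / t)) / 2 = s`. Using `k + 1` keeps the denominator at
  -- least `2π`, hence `t k ≤ 1/2`, the range of `eq_cos`.
  let t : ℕ → ℝ := fun k => Real.pi / (Real.arccos (1 - 2 * s) + (k + 1 : ℕ) * (2 * Real.pi))
  have harc := Real.arccos_nonneg (1 - 2 * (s : ℝ))
  have hden : ∀ k : ℕ, 2 * Real.pi ≤
      Real.arccos (1 - 2 * s) + (k + 1 : ℕ) * (2 * Real.pi) := by
    intro k
    have : (1 : ℝ) * (2 * Real.pi) ≤ (k + 1 : ℕ) * (2 * Real.pi) :=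
      mul_le_mul_of_nonneg_right (by push_cast; linarith [k.cast_nonneg (α := ℝ)]) (by positivity)
    linarith
  have hpos : ∀ k, 0 < t k := fun k => div_pos hpi (by linarith [hden k])
  have hlim : Tendsto t atTop (𝓝 0) := by
    refine Tendsto.div_atTop tendsto_const_nhds (tendsto_atTop_add_const_left _ _ ?_)
    exact ((tendsto_natCast_atTop_atTop (R := ℝ)).comp (tendsto_add_atTop_nat 1)).atTop_mul_const
      (by positivity)
  have hval : ∀ k, U (Susp.pt g x₀ (t k)) = s := by
    intro k
    apply Subtype.ext
    rw [hU.eq_cos (t k) (hpos k)]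
    · simp only [t]
      rw [div_div_cancel₀ hpi.ne', Real.cos_add_nat_mul_two_pi,
        Real.cos_arccos (by linarith [s.2.2]) (by linarith [s.2.1])]
      ring
    · rw [div_le_div_iff₀ (by linarith [hden k]) (by norm_num)]
      linarith [hden k]
  obtain ⟨N, hN⟩ := eventually_atTop.1 (hlim.eventually (gt_mem_nhds hε))
  exact ⟨fun k => t (k + N), hlim.comp (tendsto_add_atTop_nat N),
    fun k => ⟨hpos _, hN _ (by lia), hval _⟩⟩

end IsSineCut

/-- The sequence `(U (φ^{nτ} y))ₙ` over the point `y = φ^t (x₀, 0)`. -/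
noncomputable def curve (x₀ : W) (τ : ℝ) (U : Susp g → unitInterval) (t : ℝ) :
    Susp g × (ℤ → unitInterval) :=
  (Susp.pt g x₀ t, fun n => U (Susp.pt g x₀ (n * τ + t)))

open Classical in
/-- The point of the fibre over `φ^{iτ} (x₀, 0)` with the free coordinate equal to `s`. -/
noncomputable def fibrePt (x₀ : W) (τ : ℝ) (U : Susp g → unitInterval) (i : ℤ) (s : unitInterval) :
    Susp g × (ℤ → unitInterval) :=
  (Susp.pt g x₀ (i * τ), Function.update (curve x₀ τ U (i * τ)).2 (-i) s)

theorem flowHomeo_zpow_pt (n : ℤ) (t : ℝ) :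
    (flowHomeo g τ ^ n) (Susp.pt g x₀ t) = Susp.pt g x₀ (n * τ + t) := by
  rw [flowHomeo_zpow]
  exact flowMap_pt g _ _ _

theorem pt_mem_orbitPM_iff (hU : IsSineCut g x₀ U) (t : ℝ) :
    Susp.pt g x₀ t ∈ orbitPM (flowHomeo g τ) (Susp.mk g x₀ 0) ↔ ∃ n : ℤ, t = n * τ := by
  simp only [orbitPM, mem_ofPred_eq, ← Susp.pt_zero, flowHomeo_zpow_pt, add_zero]
  exact exists_congr fun n => hU.injective.eq_iff

theorem notMem_orbitPM_of_mem_Ioo (hU : IsSineCut g x₀ U) (hτ : 0 < τ) {t : ℝ} {i : ℤ}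
    (ht : t ∈ Ioo (((i - 1 : ℤ) : ℝ) * τ) (i * τ)) :
    Susp.pt g x₀ t ∉ orbitPM (flowHomeo g τ) (Susp.mk g x₀ 0) := by
  rw [pt_mem_orbitPM_iff hU]
  rintro ⟨n, rfl⟩
  have h1 : (i - 1 : ℤ) < n := by exact_mod_cast lt_of_mul_lt_mul_right ht.1 hτ.le
  have h2 : n < i := by exact_mod_cast lt_of_mul_lt_mul_right ht.2 hτ.le
  lia

theorem curve_eq (t : ℝ) : curve x₀ τ U t =
    (Susp.pt g x₀ t, fun n => U ((flowHomeo g τ ^ n) (Susp.pt g x₀ t))) := by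
  simp only [curve, flowHomeo_zpow_pt]

theorem curve_mem_of_mem_Ioo (hU : IsSineCut g x₀ U) (hτ : 0 < τ) {t : ℝ} {i : ℤ}
    (ht : t ∈ Ioo (((i - 1 : ℤ) : ℝ) * τ) (i * τ)) :
    curve x₀ τ U t ∈ seqSpace (flowHomeo g τ) (Susp.mk g x₀ 0) U := by
  rw [curve_eq]
  exact mem_seqSpace_of_notMem _ _ _ (notMem_orbitPM_of_mem_Ioo hU hτ ht)

/-- Approach `iτ` from the right along times `iτ + t k` with `U = s` at time `t k`: coordinate `-i`
is constantly `s`, the others converge by continuity. The interval is written as the one belonging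
to index `i + 1`. -/
theorem fibrePt_mem_closure [T1Space (Susp g)] (hU : IsSineCut g x₀ U) (hτ : 0 < τ) (i : ℤ)
    (s : unitInterval) :
    fibrePt x₀ τ U i s ∈
      closure (curve x₀ τ U '' Ioo (((i + 1 - 1 : ℤ) : ℝ) * τ) ((i + 1 : ℤ) * τ)) := by
  obtain ⟨t, ht, hts⟩ := hU.exists_seq_eq s hτ
  have ht' : Tendsto (fun k => i * τ + t k) atTop (𝓝 (i * τ)) := by
    simpa using tendsto_const_nhds.add ht
  refine mem_closure_of_tendsto (f := fun k => curve x₀ τ U (i * τ + t k)) (b := atTop) ?_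
    (Eventually.of_forall fun k => ⟨_, ?_, rfl⟩)
  · refine Tendsto.prodMk_nhds (((continuous_pt_right x₀).tendsto _).comp ht') ?_
    rw [tendsto_pi_nhds]
    intro n
    by_cases hn : n = -i
    · subst hn
      simp only [Function.update_self]
      refine tendsto_const_nhds.congr fun k => ?_
      rw [show ((-i : ℤ) : ℝ) * τ + (i * τ + t k) = t k by push_cast; ring, (hts k).2.2]
    · rw [Function.update_of_ne hn]
      have hne : (n : ℝ) * τ + i * τ ≠ 0 := by
        rw [← add_mul]
        refine mul_ne_zero ?_ hτ.ne'
        intro h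
        have : n + i = 0 := by exact_mod_cast h
        lia
      exact (hU.continuousAt_comp_pt hne).tendsto.comp (tendsto_const_nhds.add ht')
  · have := hts k
    push_cast
    constructor <;> linarith

theorem fibrePt_mem [T1Space (Susp g)] (hU : IsSineCut g x₀ U) (hτ : 0 < τ) (i : ℤ)
    (s : unitInterval) :
    fibrePt x₀ τ U i s ∈ seqSpace (flowHomeo g τ) (Susp.mk g x₀ 0) U := by
  refine closure_minimal ?_ isClosed_closure (fibrePt_mem_closure hU hτ i s)
  rintro _ ⟨t, ht, rfl⟩
  exact curve_mem_of_mem_Ioo hU hτ ht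

/-- Coordinate `-i` is evaluated at time `0`, where `U` is `0` by convention; so the curve ends at
this end point of the arc. -/
theorem curve_mul (hU : IsSineCut g x₀ U) (i : ℤ) : curve x₀ τ U (i * τ) = fibrePt x₀ τ U i 0 := by
  refine Prod.ext rfl ?_
  simp only [fibrePt]
  rw [Function.eq_update_iff]
  refine ⟨?_, fun _ _ => rfl⟩
  simp only [curve]
  rw [show ((-i : ℤ) : ℝ) * τ + i * τ = 0 by push_cast; ring]
  exact hU.eq_zero 0 (by norm_num) le_rfl

theorem eq_fibrePt_of_mem [T1Space (Susp g)] (hU : IsSineCut g x₀ U) (hτ : 0 < τ) {i : ℤ}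
    {z : Susp g × (ℤ → unitInterval)} (hz : z ∈ seqSpace (flowHomeo g τ) (Susp.mk g x₀ 0) U)
    (h : z.1 = Susp.pt g x₀ (i * τ)) : z = fibrePt x₀ τ U i (z.2 (-i)) := by
  refine Prod.ext h ?_
  simp only [fibrePt]
  rw [Function.eq_update_iff]
  refine ⟨rfl, fun n hn => ?_⟩
  have h1 : (flowHomeo g τ ^ n) z.1 = Susp.pt g x₀ (n * τ + i * τ) := by
    rw [h, flowHomeo_zpow_pt]
  rw [seqSpace_snd_apply hU.continuousOn hz, h1]
  · rfl
  · rw [h1]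
    refine hU.pt_ne ?_
    rw [← add_mul]
    refine mul_ne_zero ?_ hτ.ne'
    intro h
    have : n + i = 0 := by exact_mod_cast h
    lia

theorem eq_curve_of_mem [T1Space (Susp g)] (hU : IsSineCut g x₀ U) (hτ : 0 < τ) {i : ℤ} {t : ℝ}
    (ht : t ∈ Ioo (((i - 1 : ℤ) : ℝ) * τ) (i * τ))
    {z : Susp g × (ℤ → unitInterval)} (hz : z ∈ seqSpace (flowHomeo g τ) (Susp.mk g x₀ 0) U)
    (h : z.1 = Susp.pt g x₀ t) : z = curve x₀ τ U t := by
  rw [curve_eq, ← h]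
  exact eq_of_mem_seqSpace hU.continuousOn hz (h ▸ notMem_orbitPM_of_mem_Ioo hU hτ ht)

/-- Within this interval a coordinate can jump only at the right end `iτ`, for `n = -i`; there the
approach is from the left, where `U` is continuous. -/
theorem continuousOn_curve [T1Space (Susp g)] (hU : IsSineCut g x₀ U) (hτ : 0 < τ) (i : ℤ) :
    ContinuousOn (curve x₀ τ U) (Ioc (((i - 1 : ℤ) : ℝ) * τ) (i * τ)) := by
  intro t ht
  refine ContinuousWithinAt.prodMk (continuous_pt_right x₀).continuousWithinAt ?_
  rw [continuousWithinAt_pi]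
  intro n
  by_cases h0 : (n : ℝ) * τ + t = 0
  · have hti : t = i * τ := by
      have h1 : t = ((-n : ℤ) : ℝ) * τ := by push_cast; linarith
      have h2 : (i - 1 : ℤ) < -n := by
        exact_mod_cast lt_of_mul_lt_mul_right (h1 ▸ ht.1) hτ.le
      have h3 : -n ≤ i := by exact_mod_cast le_of_mul_le_mul_right (h1 ▸ ht.2) hτ
      rw [h1, show -n = i by lia]
    refine ContinuousWithinAt.comp (f := fun t => (n : ℝ) * τ + t)
      (g := fun t => U (Susp.pt g x₀ t)) (t := Iic ((n : ℝ) * τ + t))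
      (hU.continuousWithinAt_comp_pt ((n : ℝ) * τ + t)) (by fun_prop) ?_
    intro r hr
    rw [mem_Iic, hti]
    linarith [hr.2]
  · exact (ContinuousAt.comp (f := fun t => (n : ℝ) * τ + t)
      (g := fun t => U (Susp.pt g x₀ t)) (hU.continuousAt_comp_pt h0)
      (by fun_prop)).continuousWithinAt

end SineCurve


/-! ### Path components of the blown up space. -/

section PathComponents

variable {W : Type*} [TopologicalSpace W] {g : W ≃ₜ W} {x₀ : W} {τ : ℝ}
  {U : Susp g → unitInterval}

/-- The space obtained from the suspension by blowing up the orbit of `(x₀, 0)` under `φ^τ`. -/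
abbrev blowup (x₀ : W) (τ : ℝ) (U : Susp g → unitInterval) : Set (Susp g × (ℤ → unitInterval)) :=
  seqSpace (flowHomeo g τ) (Susp.mk g x₀ 0) U

/-- The part of the blown up space over the points `φ^t (x₀, 0)` with `(i - 1) τ < t ≤ i τ`. -/
def ray (x₀ : W) (τ : ℝ) (U : Susp g → unitInterval) (i : ℤ) : Set (blowup x₀ τ U) :=
  {z | ∃ t ∈ Ioc (((i - 1 : ℤ) : ℝ) * τ) (i * τ), z.1.1 = Susp.pt g x₀ t}

/-- The fibre over `φ^{iτ} (x₀, 0)`. -/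
def fibre (x₀ : W) (τ : ℝ) (U : Susp g → unitInterval) (i : ℤ) : Set (blowup x₀ τ U) :=
  {z | z.1.1 = Susp.pt g x₀ (i * τ)}

theorem sub_one_mul_lt (hτ : 0 < τ) (i : ℤ) : ((i - 1 : ℤ) : ℝ) * τ < i * τ :=
  mul_lt_mul_of_pos_right (by push_cast; linarith) hτ

theorem fibre_subset_ray (hτ : 0 < τ) (i : ℤ) : fibre x₀ τ U i ⊆ ray x₀ τ U i :=
  fun _ hz => ⟨i * τ, ⟨sub_one_mul_lt hτ i, le_rfl⟩, hz⟩

theorem exists_mem_ray (hτ : 0 < τ) {z : blowup x₀ τ U} {t : ℝ} (h : z.1.1 = Susp.pt g x₀ t) :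
    ∃ i, z ∈ ray x₀ τ U i := by
  refine ⟨⌈t / τ⌉, t, ⟨?_, ?_⟩, h⟩
  · rw [← lt_div_iff₀ hτ]
    push_cast
    linarith [Int.ceil_lt_add_one (t / τ)]
  · rw [← div_le_iff₀ hτ]
    exact Int.le_ceil _

theorem eq_of_mem_ray (hU : IsSineCut g x₀ U) (hτ : 0 < τ) {z : blowup x₀ τ U} {i j : ℤ}
    (hi : z ∈ ray x₀ τ U i) (hj : z ∈ ray x₀ τ U j) : i = j := by
  obtain ⟨t, ht, h⟩ := hi
  obtain ⟨t', ht', h'⟩ := hj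
  obtain rfl := hU.injective (h.symm.trans h')
  have h1 : i - 1 < j := by exact_mod_cast lt_of_mul_lt_mul_right (ht.1.trans_le ht'.2) hτ.le
  have h2 : j - 1 < i := by exact_mod_cast lt_of_mul_lt_mul_right (ht'.1.trans_le ht.2) hτ.le
  lia

/-- A point of the fibre slides along the arc; any other point of the ray follows the curve to its
right end. -/
theorem joined_fibrePt_zero [T1Space (Susp g)] (hU : IsSineCut g x₀ U) (hτ : 0 < τ) {i : ℤ}
    {z : blowup x₀ τ U} (hz : z ∈ ray x₀ τ U i) :
    Joined z ⟨fibrePt x₀ τ U i 0, fibrePt_mem hU hτ i 0⟩ := by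
  obtain ⟨t, ht, h⟩ := hz
  refine JoinedIn.joined_subtype (F := blowup x₀ τ U) (x := z.1) ?_
  rcases eq_or_lt_of_le ht.2 with h1 | h1
  · subst h1
    rw [eq_fibrePt_of_mem hU hτ z.2 h]
    have hc : Continuous (fibrePt x₀ τ U i) :=
      continuous_const.prodMk (continuous_const.update _ continuous_id)
    have : PathConnectedSpace unitInterval := isPathConnected_iff_pathConnectedSpace.1
      ((convex_Icc (0 : ℝ) 1).isPathConnected ⟨0, le_rfl, zero_le_one⟩)
    refine ((isPathConnected_univ.image hc).joinedIn _ ⟨_, mem_univ _, rfl⟩ _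
      ⟨_, mem_univ _, rfl⟩).mono ?_
    rintro _ ⟨s, -, rfl⟩
    exact fibrePt_mem hU hτ i s
  · rw [eq_curve_of_mem hU hτ ⟨ht.1, h1⟩ z.2 h, ← curve_mul hU]
    have hsub : Icc t (i * τ) ⊆ Ioc (((i - 1 : ℤ) : ℝ) * τ) (i * τ) :=
      fun r hr => ⟨ht.1.trans_le hr.1, hr.2⟩
    refine ((((convex_Icc t (i * τ)).isPathConnected ⟨t, le_rfl, ht.2⟩).image'
      ((continuousOn_curve hU hτ i).mono hsub)).joinedIn _ ⟨t, ⟨le_rfl, ht.2⟩, rfl⟩ _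
      ⟨i * τ, ⟨ht.2, le_rfl⟩, rfl⟩).mono ?_
    rintro _ ⟨r, hr, rfl⟩
    rcases eq_or_lt_of_le hr.2 with h2 | h2
    · rw [h2, curve_mul hU]
      exact fibrePt_mem hU hτ i 0
    · exact curve_mem_of_mem_Ioo hU hτ ⟨ht.1.trans_le hr.1, h2⟩

theorem joined_of_mem_ray [T1Space (Susp g)] (hU : IsSineCut g x₀ U) (hτ : 0 < τ) {i : ℤ}
    {z z' : blowup x₀ τ U} (hz : z ∈ ray x₀ τ U i) (hz' : z' ∈ ray x₀ τ U i) : Joined z z' :=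
  (joined_fibrePt_zero hU hτ hz).trans (joined_fibrePt_zero hU hτ hz').symm

theorem exists_flow_lift_of_joined [CompactSpace W] [T2Space W] [TotallyDisconnectedSpace W]
    {z z' : blowup x₀ τ U} (h : Joined z z') :
    ∃ (σ : Path z z') (θ : C(unitInterval, ℝ)), θ 0 = 0 ∧
      ∀ s, (σ s).1.1 = flowMap g (θ s) z.1.1 := by
  obtain ⟨σ⟩ := h
  obtain ⟨θ, h0, hθ⟩ := exists_flow_lift_of_path g (⟨fun s => (σ s).1.1, by fun_prop⟩)
  exact ⟨σ, θ, h0, fun s => by simpa using hθ s⟩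

/-- A path cannot cross a fibre from left to right. -/
theorem exists_pt_le_of_joined [CompactSpace W] [T2Space W] [TotallyDisconnectedSpace W]
    (hU : IsSineCut g x₀ U) (hτ : 0 < τ) {i : ℤ} {z z' : blowup x₀ τ U} (h : Joined z z') {t : ℝ}
    (hz : z.1.1 = Susp.pt g x₀ t) (ht : t ≤ i * τ) :
    ∃ t' ≤ i * τ, z'.1.1 = Susp.pt g x₀ t' := by
  obtain ⟨σ, θ, hθ0, hθ⟩ := exists_flow_lift_of_joined h
  simp only [hz, flowMap_pt] at hθ
  refine ⟨θ 1 + t, ?_, by simpa using hθ 1⟩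
  by_contra! hlt
  have hcomp : IsCompact {s : unitInterval | θ s + t ≤ i * τ} :=
    (isClosed_le (by fun_prop) continuous_const).isCompact
  -- Here `m` is the last moment at which the path is not to the right of `iτ`.
  obtain ⟨m, hm, hmax⟩ := hcomp.exists_isGreatest ⟨0, by simpa [hθ0] using ht⟩
  -- Just after `m` the path runs through the oscillating curve, so coordinate `-i` takes the value
  -- `e` at moments accumulating at `m`; this for every `e` is absurd.
  have hq : ∀ e : unitInterval, (σ m).1.2 (-i) = e := by
    intro e
    -- The bound `τ` keeps `iτ + r k` before the next fibre; the other bound keeps it below the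
    -- final time of the path, for the intermediate value theorem.
    obtain ⟨r, hr0, hr⟩ := hU.exists_seq_eq e (lt_min hτ (sub_pos.2 hlt))
    have hex : ∀ k, ∃ s ∈ Icc m 1, θ s + t = i * τ + r k := by
      intro k
      have hrk := hr k
      have hivt := intermediate_value_Icc (f := fun s => θ s + t) (unitInterval.le_one' (t := m))
        (by fun_prop)
      refine hivt ⟨?_, ?_⟩
      · change θ m + t ≤ i * τ at hm
        linarith
      · linarith [hrk.2.1.trans_le (min_le_right _ _)]
    choose s hs hsr using hex
    obtain ⟨l, -, φ, hφ, hl⟩ := isCompact_univ.tendsto_subseq fun k => mem_univ (s k)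
    have hθl : θ l + t = i * τ := by
      refine tendsto_nhds_unique
        (((θ.continuous.add continuous_const).tendsto l).comp hl) ?_
      refine Tendsto.congr (fun k => (hsr (φ k)).symm) ?_
      simpa using (tendsto_const_nhds (x := i * τ)).add (hr0.comp hφ.tendsto_atTop)
    obtain rfl : l = m := le_antisymm (hmax hθl.le)
      (ge_of_tendsto hl (Eventually.of_forall fun k => (hs _).1))
    have hc : Continuous fun s => (σ s).1.2 (-i) := by fun_prop
    refine tendsto_nhds_unique ((hc.tendsto l).comp hl) ?_
    refine tendsto_const_nhds.congr fun k => ?_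
    have hrk := hr (φ k)
    have hmem : i * τ + r (φ k) ∈ Ioo (((i + 1 - 1 : ℤ) : ℝ) * τ) ((i + 1 : ℤ) * τ) := by
      push_cast
      constructor <;> linarith [hrk.2.1.trans_le (min_le_left _ _)]
    have := eq_curve_of_mem hU hτ hmem (σ (s (φ k))).2 (by rw [hθ, hsr])
    simp only [Function.comp_apply, this, curve]
    rw [show ((-i : ℤ) : ℝ) * τ + (i * τ + r (φ k)) = r (φ k) by push_cast; ring, hrk.2.2]
  exact zero_ne_one ((hq 0).symm.trans (hq 1))

/-- A path from the ray cannot pass `iτ` to the right, and if it reached `(i - 1)τ` on the left, its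
reverse would cross that fibre to the right. -/
theorem joined_iff_of_mem_ray [CompactSpace W] [T2Space W] [TotallyDisconnectedSpace W]
    (hU : IsSineCut g x₀ U) (hτ : 0 < τ) {i : ℤ} {z z' : blowup x₀ τ U} (hz : z ∈ ray x₀ τ U i) :
    Joined z z' ↔ z' ∈ ray x₀ τ U i := by
  refine ⟨fun h => ?_, joined_of_mem_ray hU hτ hz⟩
  obtain ⟨t, ht, htz⟩ := hz
  obtain ⟨t', ht', htz'⟩ := exists_pt_le_of_joined hU hτ h htz ht.2
  refine ⟨t', ⟨?_, ht'⟩, htz'⟩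
  by_contra! hlt
  obtain ⟨t'', ht'', h''⟩ := exists_pt_le_of_joined hU hτ h.symm htz' hlt
  rw [hU.injective (h''.symm.trans htz)] at ht''
  exact absurd ht.1 ht''.not_gt

/-- The ray projects into a compact arc of the flow line, so only points over its left end can be
added; the oscillation adds that whole fibre. -/
theorem closure_ray_diff [T2Space W] (hU : IsSineCut g x₀ U) (hτ : 0 < τ)
    (i : ℤ) : closure (ray x₀ τ U i) \ ray x₀ τ U i = fibre x₀ τ U (i - 1) := by
  ext z
  constructor
  · rintro ⟨hz, hzn⟩
    have hcl : IsClosed {z : blowup x₀ τ U |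
        z.1.1 ∈ Susp.pt g x₀ '' Icc (((i - 1 : ℤ) : ℝ) * τ) (i * τ)} :=
      ((isCompact_Icc.image (continuous_pt_right x₀)).isClosed).preimage
        (continuous_fst.comp continuous_subtype_val)
    obtain ⟨t, ht, htz⟩ := closure_minimal (fun z hz => by
      obtain ⟨t, ht, htz⟩ := hz
      exact ⟨t, ⟨ht.1.le, ht.2⟩, htz.symm⟩) hcl hz
    rcases eq_or_lt_of_le ht.1 with h1 | h1
    · rw [fibre, mem_ofPred_eq, ← htz, h1]
    · exact absurd ⟨t, ⟨h1, ht.2⟩, htz.symm⟩ hzn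
  · intro hz
    refine ⟨?_, ?_⟩
    · rw [closure_subtype, eq_fibrePt_of_mem hU hτ z.2 hz]
      refine closure_mono ?_ (fibrePt_mem_closure hU hτ (i - 1) _)
      rintro _ ⟨t, ht, rfl⟩
      rw [sub_add_cancel] at ht
      exact ⟨⟨_, curve_mem_of_mem_Ioo hU hτ ht⟩, ⟨t, ⟨ht.1, ht.2.le⟩, rfl⟩, rfl⟩
    · intro hz'
      have := eq_of_mem_ray hU hτ hz' (fibre_subset_ray hτ _ hz)
      lia

/-- The frontier `closure C \ C` of the path component `C` of `z` is not a union of path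
components. -/
def HasRayType {X : Type*} [TopologicalSpace X] (z : X) : Prop :=
  ∃ p q : X, p ∈ closure (pathComponent z) \ pathComponent z ∧
    q ∉ closure (pathComponent z) \ pathComponent z ∧ Joined p q

theorem joined_map_iff {X X' : Type*} [TopologicalSpace X] [TopologicalSpace X'] (k : X ≃ₜ X')
    {x y : X} : Joined (k x) (k y) ↔ Joined x y :=
  ⟨fun h => by simpa using h.map k.symm.continuous, fun h => h.map k.continuous⟩

theorem HasRayType.map {X X' : Type*} [TopologicalSpace X] [TopologicalSpace X'] {z : X}
    (h : HasRayType z) (k : X ≃ₜ X') : HasRayType (k z) := by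
  have hc : k ⁻¹' pathComponent (k z) = pathComponent z :=
    Set.ext fun y => joined_map_iff k
  have hcl : k ⁻¹' (closure (pathComponent (k z)) \ pathComponent (k z)) =
      closure (pathComponent z) \ pathComponent z := by
    rw [preimage_sdiff, k.preimage_closure, hc]
  obtain ⟨p, q, hp, hq, hpq⟩ := h
  rw [← hcl] at hp hq
  exact ⟨k p, k q, hp, hq, hpq.map k.continuous⟩

theorem hasRayType_of_mem_ray [CompactSpace W] [T2Space W] [TotallyDisconnectedSpace W]
    (hU : IsSineCut g x₀ U) (hτ : 0 < τ) {i : ℤ} {z : blowup x₀ τ U} (hz : z ∈ ray x₀ τ U i) :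
    HasRayType z := by
  have hc : pathComponent z = ray x₀ τ U i := Set.ext fun y => joined_iff_of_mem_ray hU hτ hz
  rw [HasRayType, hc, closure_ray_diff hU hτ]
  -- The middle of the preceding ray, in the same path component as the fibre at `(i - 1)τ` but
  -- outside that fibre.
  let t : ℝ := ((i - 1 : ℤ) : ℝ) * τ - τ / 2
  have ht : t ∈ Ioo (((i - 1 - 1 : ℤ) : ℝ) * τ) ((i - 1 : ℤ) * τ) := by
    simp only [t]
    push_cast
    constructor <;> linarith
  let p : blowup x₀ τ U := ⟨_, fibrePt_mem hU hτ (i - 1) 0⟩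
  have hp : p ∈ fibre x₀ τ U (i - 1) := rfl
  refine ⟨p, ⟨_, curve_mem_of_mem_Ioo hU hτ ht⟩, hp, fun hq => ?_,
    joined_of_mem_ray hU hτ (fibre_subset_ray hτ _ hp) ⟨t, ⟨ht.1, ht.2.le⟩, rfl⟩⟩
  exact ht.2.ne (hU.injective hq)

theorem flowMap_notMem_range {y : Susp g} (hy : y ∉ range (Susp.pt g x₀)) (t : ℝ) :
    flowMap g t y ∉ range (Susp.pt g x₀) := by
  rintro ⟨r, hr⟩
  refine hy ⟨-t + r, ?_⟩
  rw [← flowMap_pt, hr, ← flowMap_add, neg_add_cancel, flowMap_zero]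

theorem orbitPM_subset_range :
    orbitPM (flowHomeo g τ) (Susp.mk g x₀ 0) ⊆ range (Susp.pt g x₀) := by
  rintro _ ⟨n, rfl⟩
  rw [← Susp.pt_zero, flowHomeo_zpow_pt]
  exact ⟨_, rfl⟩

theorem continuousAt_seq [T1Space (Susp g)] (hU : IsSineCut g x₀ U) {y : Susp g}
    (hy : y ∉ range (Susp.pt g x₀)) :
    ContinuousAt (fun y => (y, fun n : ℤ => U ((flowHomeo g τ ^ n) y))) y := by
  refine continuousAt_id.prodMk (continuousAt_pi.2 fun n => ?_)
  refine ContinuousAt.comp (hU.continuousOn.continuousAt (isOpen_compl_singleton.mem_nhds ?_))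
    (flowHomeo g τ ^ n).continuous.continuousAt
  exact zpow_apply_ne_of_notMem_orbitPM _ _ (fun h => hy (orbitPM_subset_range h)) n

/-- Flow lines other than that of `(x₀, 0)` avoid the blown up orbit, so they lift continuously to
the space. -/
theorem joined_iff_of_notMem_range [CompactSpace W] [T2Space W] [TotallyDisconnectedSpace W]
    (hU : IsSineCut g x₀ U) {z z' : blowup x₀ τ U} (hz : z.1.1 ∉ range (Susp.pt g x₀)) :
    Joined z z' ↔ ∃ t, z'.1.1 = flowMap g t z.1.1 := by
  constructor
  · intro h
    obtain ⟨σ, θ, -, hθ⟩ := exists_flow_lift_of_joined h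
    exact ⟨θ 1, by simpa using hθ 1⟩
  · rintro ⟨t, ht⟩
    have hn : ∀ r, flowMap g r z.1.1 ∉ orbitPM (flowHomeo g τ) (Susp.mk g x₀ 0) :=
      fun r h => flowMap_notMem_range hz r (orbitPM_subset_range h)
    have hc : Continuous fun r : ℝ =>
        (flowMap g r z.1.1, fun n : ℤ => U ((flowHomeo g τ ^ n) (flowMap g r z.1.1))) := by
      refine continuous_iff_continuousAt.2 fun r => ?_
      refine ContinuousAt.comp (f := fun r : ℝ => flowMap g r z.1.1)
        (g := fun y => (y, fun n : ℤ => U ((flowHomeo g τ ^ n) y)))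
        (continuousAt_seq hU (flowMap_notMem_range hz r)) ?_
      exact ((continuous_flowMap_uncurry g).comp
        (continuous_id.prodMk continuous_const)).continuousAt
    refine JoinedIn.joined_subtype (F := blowup x₀ τ U) (x := z.1) (y := z'.1) ?_
    refine ((isPathConnected_univ.image hc).joinedIn _ ⟨0, mem_univ _, ?_⟩ _
      ⟨t, mem_univ _, ?_⟩).mono ?_
    · have h0 := hn 0
      rw [flowMap_zero] at h0
      simp only [flowMap_zero]
      exact (eq_of_mem_seqSpace hU.continuousOn z.2 h0).symm
    · have h1 := hn t
      rw [← ht] at h1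
      simp only [← ht]
      exact (eq_of_mem_seqSpace hU.continuousOn z'.2 h1).symm
    · rintro _ ⟨r, -, rfl⟩
      exact mem_seqSpace_of_notMem _ _ _ (hn r)

theorem not_hasRayType_of_notMem_range [CompactSpace W] [T2Space W] [TotallyDisconnectedSpace W]
    (hU : IsSineCut g x₀ U) (ho : Dense (orbitPM (flowHomeo g τ) (Susp.mk g x₀ 0)))
    {z : blowup x₀ τ U} (hz : z.1.1 ∉ range (Susp.pt g x₀)) : ¬ HasRayType z := by
  rintro ⟨p, q, ⟨hp, hpn⟩, hq, hpq⟩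
  have hC : ∀ y, y ∈ pathComponent z ↔ ∃ t, y.1.1 = flowMap g t z.1.1 :=
    fun y => joined_iff_of_notMem_range hU hz
  have hmem : ∀ r, ∃ c ∈ pathComponent z, c.1 =
      (flowMap g r z.1.1, fun n : ℤ => U ((flowHomeo g τ ^ n) (flowMap g r z.1.1))) := by
    intro r
    exact ⟨⟨_, mem_seqSpace_of_notMem _ _ _
      fun h => flowMap_notMem_range hz r (orbitPM_subset_range h)⟩, (hC _).2 ⟨r, rfl⟩, rfl⟩
  have hqn : q ∉ pathComponent z := fun h => hpn (Joined.trans h hpq.symm)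
  refine hq ⟨?_, hqn⟩
  -- If `p` lies over the flow line of `(x₀, 0)`, the closure of the flow line of `z` is invariant
  -- and contains that line, hence is all of `Y`. The closure of the component then maps onto `Y`,
  -- so it contains every point alone in its fibre and is the whole space.
  by_cases hpr : p.1.1 ∈ range (Susp.pt g x₀)
  · obtain ⟨r, hr⟩ := hpr
    suffices h : closure (pathComponent z) = univ from h ▸ mem_univ q
    have hπ := continuous_seqProj (flowHomeo g τ) (Susp.mk g x₀ 0) U
    have hflow : ∀ t, MapsTo (flowMap g t) (closure (range fun s => flowMap g s z.1.1))
        (closure (range fun s => flowMap g s z.1.1)) := by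
      intro t
      refine MapsTo.closure ?_ (continuous_flowMap g t)
      rintro _ ⟨s, rfl⟩
      exact ⟨t + s, flowMap_add g t s _⟩
    have hpcl : p.1.1 ∈ closure (range fun s => flowMap g s z.1.1) := by
      change seqProj (flowHomeo g τ) (Susp.mk g x₀ 0) U p ∈ _
      refine map_mem_closure hπ hp fun c hc => ?_
      obtain ⟨t, ht⟩ := (hC c).1 hc
      exact ⟨t, ht.symm⟩
    have huniv : closure (range fun s => flowMap g s z.1.1) = univ := by
      rw [← univ_subset_iff, ← ho.closure_eq]
      refine closure_minimal (fun y hy => ?_) isClosed_closure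
      obtain ⟨t, rfl⟩ := orbitPM_subset_range hy
      have := hflow (t - r) hpcl
      rwa [← hr, flowMap_pt, sub_add_cancel] at this
    have himg : seqProj (flowHomeo g τ) (Susp.mk g x₀ 0) U '' closure (pathComponent z) = univ := by
      rw [← univ_subset_iff, ← huniv]
      refine closure_minimal ?_ (isClosedMap_seqProj _ _ _ _ isClosed_closure)
      rintro _ ⟨s, rfl⟩
      obtain ⟨c, hc, hcs⟩ := hmem s
      exact ⟨c, subset_closure hc, congrArg Prod.fst hcs⟩
    rw [← univ_subset_iff, ← (dense_notMem_orbitPM (flowHomeo g τ) (Susp.mk g x₀ 0) U).closure_eq]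
    refine closure_minimal (fun y hy => ?_) isClosed_closure
    obtain ⟨c, hc, hcy⟩ := himg.ge (mem_univ (seqProj (flowHomeo g τ) (Susp.mk g x₀ 0) U y))
    exact seqProj_injOn hU.continuousOn hy hcy.symm ▸ hc
  -- Otherwise `q` is the image of `p` under the flow at time `t`. That flow map lifts continuously
  -- at `p` and carries the component of `z` into itself, so `q` is in its closure.
  · obtain ⟨t, ht⟩ := (joined_iff_of_notMem_range hU hpr).1 hpq
    have hqr := flowMap_notMem_range hpr t
    have hq1 := eq_of_mem_seqSpace hU.continuousOn q.2
      (fun h => hqr (ht ▸ orbitPM_subset_range h))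
    rw [closure_subtype, hq1, ht]
    have hcont : ContinuousAt (fun c : blowup x₀ τ U => (flowMap g t c.1.1,
        fun n : ℤ => U ((flowHomeo g τ ^ n) (flowMap g t c.1.1)))) p :=
      ContinuousAt.comp (f := fun c : blowup x₀ τ U => flowMap g t c.1.1)
        (g := fun y => (y, fun n : ℤ => U ((flowHomeo g τ ^ n) y))) (continuousAt_seq hU hqr)
        ((continuous_flowMap g t).comp (continuous_fst.comp continuous_subtype_val)).continuousAt
    have := mem_closure_iff_nhdsWithin_neBot.1 hp
    refine mem_closure_of_tendsto (hcont.mono_left (nhdsWithin_le_nhds (s := pathComponent z))) ?_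
    filter_upwards [self_mem_nhdsWithin] with c hc
    obtain ⟨r, hr⟩ := (hC c).1 hc
    obtain ⟨c', hc', h'⟩ := hmem (t + r)
    refine ⟨c', hc', ?_⟩
    rw [h', flowMap_add, ← hr]

end PathComponents


/-! ### Rigidity of the blown up space and preparation of `u`. -/

section Rigidity

variable {W : Type*} [TopologicalSpace W] {g : W ≃ₜ W} {x₀ : W} {τ : ℝ}
  {U : Susp g → unitInterval}

/-- The rays are exactly the path components whose points satisfy `HasRayType`, a topological
invariant. -/
theorem exists_ray_preimage_eq [CompactSpace W] [T2Space W] [TotallyDisconnectedSpace W]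
    (hU : IsSineCut g x₀ U) (hτ : 0 < τ) (ho : Dense (orbitPM (flowHomeo g τ) (Susp.mk g x₀ 0)))
    (k : blowup x₀ τ U ≃ₜ blowup x₀ τ U) (i : ℤ) : ∃ m, k ⁻¹' ray x₀ τ U m = ray x₀ τ U i := by
  let z : blowup x₀ τ U := ⟨_, fibrePt_mem hU hτ i 0⟩
  have hz : z ∈ ray x₀ τ U i := fibre_subset_ray hτ i rfl
  have hkz := (hasRayType_of_mem_ray hU hτ hz).map k
  have hr : (k z).1.1 ∈ range (Susp.pt g x₀) := by
    by_contra h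
    exact not_hasRayType_of_notMem_range hU ho h hkz
  obtain ⟨t, ht⟩ := hr
  obtain ⟨m, hm⟩ := exists_mem_ray hτ ht.symm
  refine ⟨m, Set.ext fun y => ?_⟩
  rw [mem_preimage, ← joined_iff_of_mem_ray hU hτ hm, joined_map_iff,
    joined_iff_of_mem_ray hU hτ hz]

/-- A homeomorphism of the blown up space shifts the fibres over the orbit of `(x₀, 0)`. -/
theorem exists_fibre_preimage_eq [CompactSpace W] [T2Space W] [TotallyDisconnectedSpace W]
    (hU : IsSineCut g x₀ U) (hτ : 0 < τ) (ho : Dense (orbitPM (flowHomeo g τ) (Susp.mk g x₀ 0)))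
    (k : blowup x₀ τ U ≃ₜ blowup x₀ τ U) :
    ∃ m : ℤ, ∀ i, k ⁻¹' fibre x₀ τ U (i + m) = fibre x₀ τ U i := by
  choose m hm using exists_ray_preimage_eq hU hτ ho k
  have hfib : ∀ i, k ⁻¹' fibre x₀ τ U (m i - 1) = fibre x₀ τ U (i - 1) := by
    intro i
    rw [← closure_ray_diff hU hτ, ← closure_ray_diff hU hτ, preimage_sdiff, k.preimage_closure, hm]
  -- The fibre at `(i - 1)τ` belongs to ray `i - 1` and is also the frontier of ray `i`; comparing
  -- the images under `k` forces consecutive rays to go to consecutive rays.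
  have hstep : ∀ i, m (i - 1) = m i - 1 := by
    intro i
    let z : blowup x₀ τ U := ⟨_, fibrePt_mem hU hτ (i - 1) 0⟩
    have hz : z ∈ fibre x₀ τ U (i - 1) := rfl
    have h1 : k z ∈ ray x₀ τ U (m (i - 1)) := (hm (i - 1)).ge (fibre_subset_ray hτ _ hz)
    have h2 : k z ∈ ray x₀ τ U (m i - 1) := fibre_subset_ray hτ _ ((hfib i).ge hz)
    exact eq_of_mem_ray hU hτ h1 h2
  have hlin : ∀ i, m i = i + m 0 := by
    intro i
    induction i with
    | zero => simp
    | succ j ih => have := hstep (j + 1); rw [add_sub_cancel_right] at this; lia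
    | pred j ih => have := hstep (-j); lia
  refine ⟨m 0, fun i => ?_⟩
  have := hfib (i + 1)
  rwa [hlin, add_sub_cancel_right, show i + 1 + m 0 - 1 = i + m 0 by ring] at this

theorem exists_eq_seqShift_zpow [CompactSpace W] [T2Space W] [TotallyDisconnectedSpace W]
    (hU : IsSineCut g x₀ U) (hτ : 0 < τ) (ho : Dense (orbitPM (flowHomeo g τ) (Susp.mk g x₀ 0)))
    (hd : Dense (orbitPM (flowHomeo g τ) (Susp.mk g x₀ 0))ᶜ)
    (k : blowup x₀ τ U ≃ₜ blowup x₀ τ U) :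
    ∃ n : ℤ, k = seqShift (flowHomeo g τ) (Susp.mk g x₀ 0) U ^ n := by
  obtain ⟨m, hm⟩ := exists_fibre_preimage_eq hU hτ ho k
  have h : seqShift (flowHomeo g τ) (Susp.mk g x₀ 0) U ^ (-m) * k = 1 := by
    refine eq_one_of_seqProj_eq hU.continuousOn hd ho _ fun z hz => ?_
    obtain ⟨n, hn⟩ := hz
    replace hn := hn.trans (show _ = Susp.pt g x₀ (n * τ) by
      rw [← Susp.pt_zero, flowHomeo_zpow_pt, add_zero])
    have hkz : seqProj (flowHomeo g τ) (Susp.mk g x₀ 0) U (k z) =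
        Susp.pt g x₀ ((n + m : ℤ) * τ) := (hm n).ge hn
    refine (seqProj_seqShift_zpow _ _ _ (-m) (k z)).trans ?_
    rw [hkz, flowHomeo_zpow_pt, hn]
    congr 1
    push_cast
    ring
  rw [zpow_neg, inv_mul_eq_one] at h
  exact ⟨m, h.symm⟩

/-- Any small forward flow leaves the orbit, whose points on the flow line of `(x₀, 0)` are spaced
by `τ`. -/
theorem dense_compl_orbitPM (hU : IsSineCut g x₀ U) (hτ : 0 < τ) :
    Dense (orbitPM (flowHomeo g τ) (Susp.mk g x₀ 0))ᶜ := by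
  intro y
  have hlim : Tendsto (fun t : ℝ => flowMap g t y) (𝓝[>] 0) (𝓝 y) := by
    have h : Continuous fun t : ℝ => flowMap g t y :=
      (continuous_flowMap_uncurry g).comp (continuous_id.prodMk continuous_const)
    have := h.tendsto 0
    rw [flowMap_zero] at this
    exact this.mono_left nhdsWithin_le_nhds
  refine mem_closure_of_tendsto hlim ?_
  by_cases hy : ∃ r, y = Susp.pt g x₀ r
  · obtain ⟨r, rfl⟩ := hy
    have hr := (div_lt_iff₀ hτ).1 (Int.lt_floor_add_one (r / τ))
    have hr' := (le_div_iff₀ hτ).1 (Int.floor_le (r / τ))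
    filter_upwards [Ioo_mem_nhdsGT (sub_pos.2 hr)] with t ht
    rw [flowMap_pt]
    refine notMem_orbitPM_of_mem_Ioo hU hτ (i := ⌊r / τ⌋ + 1) ⟨?_, ?_⟩
    · rw [add_sub_cancel_right]
      linarith [ht.1]
    · push_cast
      linarith [ht.2]
  · filter_upwards with t ht
    exact flowMap_notMem_range (fun ⟨r, hr⟩ => hy ⟨r, hr.symm⟩) t (orbitPM_subset_range ht)

theorem dense_orbitPM_of_omegaPt {Y : Type*} [TopologicalSpace Y] {f : Y ≃ₜ Y} {y : Y}
    (h : omegaPt f y = univ) : Dense (orbitPM f y) := by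
  intro z
  have hz : z ∈ omegaPt f y := h ▸ mem_univ z
  rw [omegaPt, mem_omegaLimit_singleton_iff_mapClusterPt, mapClusterPt_iff_frequently] at hz
  refine mem_closure_iff_nhds.2 fun V hV => ?_
  obtain ⟨n, hn⟩ := (hz V hV).exists
  exact ⟨_, hn, n, by rw [zpow_natCast]⟩

open Classical in
/-- The function `u` as a function into the unit interval, with the value `0` at `y₀`. -/
noncomputable def cutFun {Y : Type*} (y₀ : Y) (u : Y → ℝ) (y : Y) : unitInterval :=
  if y = y₀ then 0 else projIcc 0 1 zero_le_one (u y)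

theorem cutFun_self {Y : Type*} (y₀ : Y) (u : Y → ℝ) : cutFun y₀ u y₀ = 0 := if_pos rfl

theorem coe_cutFun {Y : Type*} {y₀ y : Y} {u : Y → ℝ} (hy : y ≠ y₀) (h : u y ∈ Icc (0 : ℝ) 1) :
    (cutFun y₀ u y : ℝ) = u y := by
  rw [cutFun, if_neg hy, projIcc_of_mem _ h]

theorem continuousOn_cutFun {Y : Type*} [TopologicalSpace Y] {y₀ : Y} {u : Y → ℝ}
    (hu : ContinuousOn u {y₀}ᶜ) : ContinuousOn (cutFun y₀ u) {y₀}ᶜ :=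
  (continuous_projIcc.comp_continuousOn hu).congr fun _ hy => if_neg hy

end Rigidity

end SlovakConstruction

open SlovakConstruction
theorem theorem4p05
    {W : Type*} [TopologicalSpace W] [CompactSpace W] [TopologicalSpace.MetrizableSpace W]
    [TotallyDisconnectedSpace W] [PerfectSpace W] [Nonempty W]
    (g : W ≃ₜ W) (hg : TotallyTransitive g)
    (x₀ : W) (hx₀ : ∀ n : ℤ, n ≠ 0 → IsTransPt (g ^ n) x₀)
    (τ : ℝ) (hτ0 : 0 < τ) (hτ1 : τ < 1)
    (hτ : ∀ n : ℤ, n ≠ 0 →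
      omegaPt (flowHomeo g (n * τ)) (Susp.mk g x₀ 0) = Set.univ ∧
      alphaPt (flowHomeo g (n * τ)) (Susp.mk g x₀ 0) = Set.univ)
    (a : ℤ → ℝ) (ha_pos : ∀ n, 0 < a n) (ha_sum : HasSum a 1)
    (ha_log : ∃ C : ℝ, ∀ n : ℤ, |Real.log (a n) - Real.log (a (n - 1))| ≤ C)
    (u : Susp g → ℝ) (hu_cont : ContinuousOn u {Susp.mk g x₀ 0}ᶜ)
    (hu_mem : ∀ y, y ≠ Susp.mk g x₀ 0 → u y ∈ Set.Icc (0 : ℝ) 1)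
    (hu_neg : ∀ t : ℝ, -(1 / 2) ≤ t → t < 0 → u (flowHomeo g t (Susp.mk g x₀ 0)) = 0)
    (hu_pos : ∀ t : ℝ, 0 < t → t ≤ 1 / 2 →
      u (flowHomeo g t (Susp.mk g x₀ 0)) = 1 / 2 * (1 - Real.cos (Real.pi / t))) :
    (∃! h : liftSpace (flowHomeo g τ) (Susp.mk g x₀ 0) a u ≃ₜ
        liftSpace (flowHomeo g τ) (Susp.mk g x₀ 0) a u,
      IsLift (flowHomeo g τ) (Susp.mk g x₀ 0) a u h) ∧
    ∀ h : liftSpace (flowHomeo g τ) (Susp.mk g x₀ 0) a u ≃ₜ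
        liftSpace (flowHomeo g τ) (Susp.mk g x₀ 0) a u,
      IsLift (flowHomeo g τ) (Susp.mk g x₀ 0) a u h →
        (Set.univ : Set (liftSpace (flowHomeo g τ) (Susp.mk g x₀ 0) a u ≃ₜ
          liftSpace (flowHomeo g τ) (Susp.mk g x₀ 0) a u)) = {k | ∃ n : ℤ, k = h ^ n} ∧
        ∀ n : ℤ, n ≠ 0 → TopTransitive (h ^ n) := by
  have hinj : Function.Injective (Susp.pt g x₀) :=
    Susp.pt_left_injective g (zpow_apply_ne_of_isTransPt g hx₀)
  have hpt : ∀ t, flowHomeo g t (Susp.mk g x₀ 0) = Susp.pt g x₀ t := fun t => flowMap_mk_zero g t x₀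
  have hne : ∀ t, t ≠ 0 → Susp.pt g x₀ t ≠ Susp.mk g x₀ 0 :=
    fun t ht h => ht (hinj (h.trans (Susp.pt_zero g x₀).symm))
  have hUu : ∀ y, y ≠ Susp.mk g x₀ 0 → (cutFun (Susp.mk g x₀ 0) u y : ℝ) = u y :=
    fun y hy => coe_cutFun hy (hu_mem y hy)
  have hU : IsSineCut g x₀ (cutFun (Susp.mk g x₀ 0) u) := by
    refine ⟨continuousOn_cutFun hu_cont, fun t ht ht0 => ?_, fun t ht0 ht => ?_, hinj⟩
    · rcases eq_or_lt_of_le ht0 with rfl | ht0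
      -- The time `0` is not covered by `hu_neg`; here the default value of `cutFun` enters.
      · rw [Susp.pt_zero, cutFun_self]
      · apply Subtype.ext
        rw [hUu _ (hne t ht0.ne), ← hpt, hu_neg t ht ht0]
        rfl
    · rw [hUu _ (hne t ht0.ne'), ← hpt, hu_pos t ht0 ht]
  have horb : Function.Injective fun n : ℤ => (flowHomeo g τ ^ n) (Susp.mk g x₀ 0) := by
    intro n m h
    simp only [← Susp.pt_zero, flowHomeo_zpow_pt, add_zero] at h
    exact_mod_cast mul_right_cancel₀ hτ0.ne' (hinj h)
  have ho : Dense (orbitPM (flowHomeo g τ) (Susp.mk g x₀ 0)) :=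
    dense_orbitPM_of_omegaPt (by simpa using (hτ 1 one_ne_zero).1)
  have hd := dense_compl_orbitPM hU hτ0
  refine existsUnique_isLift_and_of_seqShift ha_pos ha_sum.summable hUu hU.continuousOn horb
    (exists_eq_seqShift_zpow hU hτ0 ho hd) fun n hn => ?_
  refine topTransitive_seqShift_zpow hU.continuousOn hd ?_
  rw [flowHomeo_zpow]
  exact topTransitive_of_omegaPt_eq_univ (hτ n hn).1
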